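/- Let $(\xi(k))_{k\in\mathbb Z}$ be i.i.d. with $P(\xi(k)=0)=P(\xi(k)=1)=\tfrac12$, and let $(S(k))_{k\ge 0}$ be a simple symmetric random walk on $\mathbb Z$ with $S(0)=0$, independent of $\xi$. Let $\varphi:\mathbb Z\to\{0,1\}$ be the $4$-periodic function with $\varphi(0)=\varphi(1)=\xi(0)$ and $\varphi(2)=\varphi(3)=1-\xi(0)$, and let $R:\mathbb Z\to\mathbb Z$ be the unique function with $R(0)=0$, $|R(k+1)-R(k)|=1$ and $\varphi(R(k))=\xi(k)$ for all $k\in\mathbb Z$. For a path $T$ indexed by $\mathbb N=\{0,1,2,\dots\}$ or by $\mathbb Z$ and integers $x_1\ne x_2$, a pair of times $(t_1,t_2)$ is a *crossing by $T$ of $(x_1,x_2)$* if $T(t_1)=x_1$, $T(t_2)=x_2$ and $T(t)$ lies strictly between $x_1$ and $x_2$ for every integer $t$ strictly between $t_1$ and $t_2$ (both $t_1<t_2$ and $t_2<t_1$ are allowed); it is *straight* if $|t_1-t_2|=|x_1-x_2|$. The *first crossing by $T$ of $(x_3,x_4)$ during $(t_1,t_2)$* is the crossing by $T$ of $(x_3,x_4)$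 with both times in $[\min\{t_1,t_2\},\max\{t_1,t_2\}]$ which is closest to $t_1$. Distinct crossings of the same $(x_1,x_2)$ occupy time intervals with disjoint interiors, and crossings by a path indexed by $\mathbb N$ are numbered $1,2,\dots$ in order of appearance. For $z\in\mathbb Z\setminus\{0\}$, the *$z$-th crossing by $R$* of an interval is the $z$-th crossing by $(R(k))_{k\ge0}$ if $z>0$, and the $|z|$-th crossing by $(R(k))_{k\le0}$, counted in reverse order starting at $0$, if $z<0$. Let $n\ge1$, and let $z_a,z_b\in\mathbb Z\setminus\{0\}$ and $i_a,i_b\in\{1,2,\dots\}$ be nonrandom with $(i_a,z_a)\neq(i_b,z_b)$. Let $(t_{1a},t_{2a})$ be the $i_a$-th crossing by $S$ of the $z_a$-th crossing by $R$ of $(0,3n)$, and let $(t_{1b},t_{2b})$ be the $i_b$-th crossing by $S$ of the $z_b$-th crossing by $R$ of $(0,3n)$. Almost surely these exist and are crossings by $R\circ S$ of $(0,3n)$. For $0\le m<n$ let $w_a(m)=1$ if the first crossing by $R\circ S$ of $(3m,3m+3)$ during $(t_{1a},t_{2a})$ is straight, and $w_a(m)=0$ otherwise; define $w_b(m)$ likewise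 from $(t_{1b},t_{2b})$, and let $w_a\times w_b:=\sum_{m=0}^{n-1}w_a(m)\,w_b(m)$. Then: - ($H_0$) if $z_a=z_b$, then almost surely $(S(t_{1a}),S(t_{2a}))=(S(t_{1b}),S(t_{2b}))$, and $w_a\times w_b$ has the binomial distribution with parameters $n$ and $(3/4)^3$; - ($H_1$) if $z_a\ne z_b$, then almost surely $(S(t_{1a}),S(t_{2a}))\ne(S(t_{1b}),S(t_{2b}))$, and $w_a\times w_b$ has the binomial distribution with parameters $n$ and $(3/4)^4$. -/

import Mathlib

open MeasureTheory ProbabilityTheory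

noncomputable section

/-! ### Random sceneries and simple random walks -/

/-- The colours `ξ k`, `k ∈ ℤ`, are i.i.d. and each of them is `0` or `1` with probability `1/2`. -/
structure IsFairScenery {Ω : Type*} [MeasurableSpace Ω] (P : Measure Ω) (ξ : ℤ → Ω → Fin 2) :
    Prop where
  measurable : ∀ k, Measurable (ξ k)
  indep : iIndepFun ξ P
  fair : ∀ k c, P {ω | ξ k ω = c} = 1 / 2

/-- `S` is a simple symmetric random walk on `ℤ` starting at the origin. -/
structure IsSimpleRandomWalk {Ω : Type*} [MeasurableSpace Ω] (P : Measure Ω) (S : ℕ → Ω → ℤ) :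
    Prop where
  measurable : ∀ k, Measurable (S k)
  start : ∀ᵐ ω ∂P, S 0 ω = 0
  indep : iIndepFun (fun k ω => S (k + 1) ω - S k ω) P
  step_right : ∀ k, P {ω | S (k + 1) ω - S k ω = 1} = 1 / 2
  step_left : ∀ k, P {ω | S (k + 1) ω - S k ω = -1} = 1 / 2

/-! ### The representation of a scenery as a nearest-neighbor walk -/

/-- The 4-periodic scenery with values `c, c, 1 - c, 1 - c` at `0, 1, 2, 3`. -/
def periodicScenery (c : Fin 2) (x : ℤ) : Fin 2 :=
  if x % 4 = 0 ∨ x % 4 = 1 then c else 1 - c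

/-- The walk on `ℕ` that starts at `0` and reads the colours `ξ 0, ξ 1, ξ 2, …` on the 4-periodic
scenery with `φ 0 = φ 1 = ξ 0`: in each step it moves to the neighbor which has the right colour. -/
def halfSceneryWalk (ξ : ℤ → Fin 2) : ℕ → ℤ
  | 0 => 0
  | k + 1 =>
    if periodicScenery (ξ 0) (halfSceneryWalk ξ k + 1) = ξ (k + 1) then halfSceneryWalk ξ k + 1
    else halfSceneryWalk ξ k - 1

/-- The nearest-neighbor walk `R : ℤ → ℤ` representing the scenery `ξ`; its characterization is
`eq_sceneryWalk_iff` below. -/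
def sceneryWalk (ξ : ℤ → Fin 2) (k : ℤ) : ℤ :=
  if 0 ≤ k then halfSceneryWalk ξ k.natAbs else halfSceneryWalk (fun j => ξ (-j)) k.natAbs

theorem periodicScenery_step (c d : Fin 2) (x : ℤ) :
    (periodicScenery c (x + 1) = d ∧ periodicScenery c (x - 1) ≠ d) ∨
      (periodicScenery c (x + 1) ≠ d ∧ periodicScenery c (x - 1) = d) := by
  have h : ∀ c d : Fin 2, (c = d ∧ 1 - c ≠ d) ∨ (c ≠ d ∧ 1 - c = d) := by decide
  have h' := h c d
  unfold periodicScenery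
  have h4 : x % 4 = 0 ∨ x % 4 = 1 ∨ x % 4 = 2 ∨ x % 4 = 3 := by omega
  rcases h4 with h0 | h0 | h0 | h0
  · rw [if_pos (by omega), if_neg (by omega)]; exact h'
  · rw [if_neg (by omega), if_pos (by omega)]; tauto
  · rw [if_neg (by omega), if_pos (by omega)]; tauto
  · rw [if_pos (by omega), if_neg (by omega)]; exact h'

theorem eq_halfSceneryWalk_iff (ξ : ℤ → Fin 2) (R : ℕ → ℤ) :
    ((∀ k, |R (k + 1) - R k| = 1) ∧ R 0 = 0 ∧ ∀ k : ℕ, periodicScenery (ξ 0) (R k) = ξ k) ↔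
      R = halfSceneryWalk ξ := by
  constructor
  · rintro ⟨h1, h2, h3⟩
    funext k
    induction k with
    | zero => exact h2
    | succ k ih =>
      have hs := periodicScenery_step (ξ 0) (ξ (k + 1)) (R k)
      have h := h3 (k + 1)
      push_cast at h
      rw [halfSceneryWalk, ← ih]
      rcases (abs_eq one_pos.le).1 (h1 k) with e | e
      · have e' : R (k + 1) = R k + 1 := by omega
        rw [e'] at h ⊢
        rw [if_pos h]
      · have e' : R (k + 1) = R k - 1 := by omega
        rw [e'] at h ⊢
        rw [if_neg (by tauto)]
  · rintro rfl
    refine ⟨fun k => ?_, rfl, fun k => ?_⟩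
    · rw [halfSceneryWalk]
      split_ifs <;> simp
    · cases k with
      | zero => simp [halfSceneryWalk, periodicScenery]
      | succ k =>
        have hs := periodicScenery_step (ξ 0) (ξ (k + 1)) (halfSceneryWalk ξ k)
        rw [halfSceneryWalk]
        push_cast
        split_ifs with h
        · exact h
        · tauto

/-- `sceneryWalk ξ` is the only nearest-neighbor walk `R : ℤ → ℤ` with `R 0 = 0` and `φ ∘ R = ξ`,
where `φ` is the 4-periodic scenery determined by `ξ 0`. -/
theorem eq_sceneryWalk_iff (ξ : ℤ → Fin 2) (R : ℤ → ℤ) :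
    ((∀ k, |R (k + 1) - R k| = 1) ∧ R 0 = 0 ∧ ∀ k, periodicScenery (ξ 0) (R k) = ξ k) ↔
      R = sceneryWalk ξ := by
  have hp : ∀ k : ℕ, sceneryWalk ξ k = halfSceneryWalk ξ k := fun k => by simp [sceneryWalk]
  have hm : ∀ k : ℕ, sceneryWalk ξ (-k) = halfSceneryWalk (fun j => ξ (-j)) k := fun k => by
    rcases Nat.eq_zero_or_pos k with rfl | hk
    · simp [sceneryWalk, halfSceneryWalk]
    · rw [sceneryWalk, if_neg (by omega), Int.natAbs_neg, Int.natAbs_natCast]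
  have key : R = sceneryWalk ξ ↔ ((fun k : ℕ => R k) = halfSceneryWalk ξ ∧
      (fun k : ℕ => R (-k)) = halfSceneryWalk (fun j => ξ (-j))) := by
    constructor
    · rintro rfl
      exact ⟨funext hp, funext hm⟩
    · rintro ⟨h1, h2⟩
      funext k
      obtain ⟨k, rfl | rfl⟩ := k.eq_nat_or_neg
      · rw [hp, ← h1]
      · rw [hm, ← h2]
  rw [key, ← eq_halfSceneryWalk_iff, ← eq_halfSceneryWalk_iff]
  constructor
  · rintro ⟨h1, h2, h3⟩
    refine ⟨⟨fun k => ?_, h2, fun k => h3 k⟩, ⟨fun k => ?_, by simpa using h2, fun k => ?_⟩⟩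
    · simpa using h1 k
    · have := h1 (-(k + 1))
      rw [abs_sub_comm]
      simpa using this
    · simpa using h3 (-k)
  · rintro ⟨⟨a1, a2, a3⟩, ⟨b1, -, b3⟩⟩
    refine ⟨fun k => ?_, a2, fun k => ?_⟩
    · rcases le_or_gt 0 k with hk | hk
      · obtain ⟨j, rfl⟩ := Int.eq_ofNat_of_zero_le hk
        simpa using a1 j
      · obtain ⟨j, hj⟩ := Int.eq_ofNat_of_zero_le (show 0 ≤ -(k + 1) by omega)
        have := b1 j
        rw [abs_sub_comm] at this
        have e1 : -((j : ℤ)) = k + 1 := by omega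
        have e2 : -(((j + 1 : ℕ) : ℤ)) = k := by push_cast; omega
        simpa only [e1, e2] using this
    · obtain ⟨k, rfl | rfl⟩ := k.eq_nat_or_neg
      · exact a3 k
      · simpa using b3 k

/-! ### Crossings

The index set `ι` of the path `T` is `ℕ` or `ℤ`. A crossing `(t₁, t₂)` may be positive (`t₁ < t₂`)
or negative (`t₂ < t₁`). -/

/-- `t = (t₁, t₂)` is a crossing by `T` of `(x₁, x₂)`. -/
def IsCrossing {ι : Type*} [LinearOrder ι] (T : ι → ℤ) (x₁ x₂ : ℤ) (t : ι × ι) : Prop :=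
  x₁ ≠ x₂ ∧ T t.1 = x₁ ∧ T t.2 = x₂ ∧
    ∀ s, min t.1 t.2 < s → s < max t.1 t.2 → min x₁ x₂ < T s ∧ T s < max x₁ x₂

/-- `t` is the `i`-th crossing by `T : ℕ → ℤ` of `(x₁, x₂)` in order of appearance, `i = 1, 2, …`
(positive and negative crossings are counted together). -/
def IsNthCrossing (T : ℕ → ℤ) (x₁ x₂ : ℤ) (i : ℕ) (t : ℕ × ℕ) : Prop :=
  IsCrossing T x₁ x₂ t ∧
    {s : ℕ × ℕ | IsCrossing T x₁ x₂ s ∧ max s.1 s.2 ≤ min t.1 t.2}.encard + 1 = i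

/-- `k` is the `z`-th crossing by `R : ℤ → ℤ` of `(x₁, x₂)`, `z ∈ ℤ`, `z ≠ 0`. For `z > 0` it is the
`z`-th crossing by the path `R` restricted to `[0, ∞)`; for `z < 0` it is the `|z|`-th crossing by the
path `R` restricted to `(-∞, 0]`, counted in reverse order starting at zero. -/
def IsSignedCrossing (R : ℤ → ℤ) (x₁ x₂ z : ℤ) (k : ℤ × ℤ) : Prop :=
  IsCrossing R x₁ x₂ k ∧
    ((0 < z ∧ 0 ≤ k.1 ∧ 0 ≤ k.2 ∧
        {s : ℤ × ℤ | IsCrossing R x₁ x₂ s ∧ 0 ≤ min s.1 s.2 ∧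
          max s.1 s.2 ≤ min k.1 k.2}.encard + 1 = z.natAbs) ∨
      (z < 0 ∧ k.1 ≤ 0 ∧ k.2 ≤ 0 ∧
        {s : ℤ × ℤ | IsCrossing R x₁ x₂ s ∧ max s.1 s.2 ≤ 0 ∧
          max k.1 k.2 ≤ min s.1 s.2}.encard + 1 = z.natAbs))

/-- `t` is the `i`-th crossing by `S` of the `z`-th crossing by `R` of `(0, 3n)`. -/
def IsIndexedCrossing (R : ℤ → ℤ) (S : ℕ → ℤ) (n i : ℕ) (z : ℤ) (t : ℕ × ℕ) : Prop :=
  ∃ k : ℤ × ℤ, IsSignedCrossing R 0 (3 * n) z k ∧ IsNthCrossing S k.1 k.2 i t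

/-- The `i`-th crossing by `S` of the `z`-th crossing by `R` of `(0, 3n)` (an arbitrary pair if there
is no such crossing). -/
def indexedCrossing (R : ℤ → ℤ) (S : ℕ → ℤ) (n i : ℕ) (z : ℤ) : ℕ × ℕ :=
  Classical.epsilon (IsIndexedCrossing R S n i z)

/-! ### The test statistic -/

/-- `s` is the first crossing by `T` of `(x₁, x₂)` during `t = (t₁, t₂)`: both times of `s` lie in
`[min t₁ t₂, max t₁ t₂]`, and among all such crossings `s` is the closest one to `t₁`. -/
def IsFirstCrossingDuring (T : ℕ → ℤ) (x₁ x₂ : ℤ) (t s : ℕ × ℕ) : Prop :=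
  IsCrossing T x₁ x₂ s ∧ s.1 ∈ Set.uIcc t.1 t.2 ∧ s.2 ∈ Set.uIcc t.1 t.2 ∧
    ∀ r : ℕ × ℕ, IsCrossing T x₁ x₂ r → r.1 ∈ Set.uIcc t.1 t.2 → r.2 ∈ Set.uIcc t.1 t.2 →
      |(s.1 : ℤ) - t.1| ≤ |(r.1 : ℤ) - t.1| ∧ |(s.2 : ℤ) - t.1| ≤ |(r.2 : ℤ) - t.1|

open Classical in
/-- The bit `w(m)` of the binary word of the crossing `t` by `T`: it is `1` if the first crossing by
`T` of `(3m, 3m + 3)` during `t` is straight, and `0` otherwise. -/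
def straightBit (T : ℕ → ℤ) (t : ℕ × ℕ) (m : ℕ) : ℕ :=
  if ∃ s, IsFirstCrossingDuring T (3 * m) (3 * m + 3) t s ∧
      |(s.1 : ℤ) - s.2| = |(3 * m : ℤ) - (3 * m + 3)| then 1 else 0

/-- The scalar product `w_a × w_b` of the binary words of length `n` of the crossings `a` and `b`
by `T`. -/
def commonStraight (T : ℕ → ℤ) (n : ℕ) (a b : ℕ × ℕ) : ℕ :=
  ∑ m ∈ Finset.range n, straightBit T a m * straightBit T b m

/-- The number `3/4` as an element of the unit interval. -/
def threeQuarters : unitInterval := ⟨3 / 4, by norm_num, by norm_num⟩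

end

/-! The core is that a simple random walk crosses an interval of length three straight with
probability 3/4, independently for many crossings at once. Call the first crossing of `(j₁, j₂)`
during the i-th crossing of `(k₁, k₂)` a locus. If `|j₁ - j₂| = 3`, the interval has only two inner
points, so a locus that is not straight must start with a step inwards, a second step, and the
reversal of the second step. Deleting the second step and its reversal gives a nearest-neighbor path
whose locus with the same label begins at the same time; conversely, inserting such a backtrack
always makes the locus non-straight. The two deleted steps have the prescribed values with
probability 1/4 and are independent of the remaining steps, which again form a simple random walk.
Other loci stay straight or non-straight under the deletion, provided their labels use no inner
point of the interval and the loci are separated. So each locus fails with probability 1/4 given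
that any collection of the others is straight, and N loci are all straight with probability (3/4)^N
(`measure_forall_isStraightLocus`).

The scenery enters through R: its step at k is +1 exactly when "ξ(k+1) = ξ(k)" and "k is even" are
equivalent. Hence its steps are independent and fair, and the two halves of R are independent simple
random walks.

The first crossing by R ∘ S of `(3m, 3m + 3)` is the first crossing by S of the first crossing by R
of that interval (`IsFirstCrossingDuring.comp`), and it is straight if and only if both of these are
(`straightBit_eq_one_iff`). For a set M of indices, the event that both bits are 1 at every m in M
therefore concerns 2|M| loci of S, which are distinct because the pairs (i, z) differ, and |M| loci
of R if za = zb but 2|M| otherwise. Fixing R and integrating over S gives (3/4)^(3|M|) or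
(3/4)^(4|M|) (`measure_forall_mem_bothStraight`). These product formulas for all M determine the
binomial law by inclusion and exclusion. -/

/-! ### Crossings by nearest-neighbor paths -/

/-- Successive values of the path `T` differ by one. -/
def IsNearestNeighbor (T : ℕ → ℤ) : Prop := ∀ k, T (k + 1) = T k + 1 ∨ T (k + 1) = T k - 1

theorem IsNearestNeighbor.exists_eq_of_le {T : ℕ → ℤ} (hT : IsNearestNeighbor T) {a b : ℕ}
    (hab : a ≤ b) {v : ℤ} (hv : v ∈ Set.uIcc (T a) (T b)) : ∃ c, a ≤ c ∧ c ≤ b ∧ T c = v := by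
  induction b, hab using Nat.le_induction with
  | base => exact ⟨a, le_rfl, le_rfl, by rw [Set.uIcc_self] at hv; exact hv.symm⟩
  | succ b hb ih =>
    by_cases h : v ∈ Set.uIcc (T a) (T b)
    · obtain ⟨c, h1, h2, h3⟩ := ih h
      exact ⟨c, h1, by omega, h3⟩
    · refine ⟨b + 1, by omega, le_rfl, ?_⟩
      rw [Set.mem_uIcc] at h hv
      have := hT b
      omega

/-- A discrete intermediate value theorem. -/
theorem IsNearestNeighbor.exists_eq {T : ℕ → ℤ} (hT : IsNearestNeighbor T) {a b : ℕ} {v : ℤ}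
    (hv : v ∈ Set.uIcc (T a) (T b)) : ∃ c ∈ Set.uIcc a b, T c = v := by
  rcases le_total a b with h | h
  · obtain ⟨c, h1, h2, h3⟩ := hT.exists_eq_of_le h hv
    exact ⟨c, Set.mem_uIcc.2 (Or.inl ⟨h1, h2⟩), h3⟩
  · rw [Set.uIcc_comm] at hv
    obtain ⟨c, h1, h2, h3⟩ := hT.exists_eq_of_le h hv
    exact ⟨c, Set.mem_uIcc.2 (Or.inr ⟨h1, h2⟩), h3⟩

theorem IsNearestNeighbor.abs_sub_le {T : ℕ → ℤ} (hT : IsNearestNeighbor T) (a b : ℕ) :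
    |T a - T b| ≤ |(a : ℤ) - b| := by
  wlog h : a ≤ b generalizing a b
  · rw [abs_sub_comm, abs_sub_comm (a : ℤ)]
    exact this b a (by omega)
  induction b, h using Nat.le_induction with
  | base => simp
  | succ b hb ih =>
    have := hT b
    push_cast
    rw [abs_le] at ih ⊢
    rw [abs_of_nonpos (by omega)] at ih ⊢
    omega

section LinearOrder

variable {ι : Type*} [LinearOrder ι] {T : ι → ℤ} {x₁ x₂ : ℤ} {s t : ι × ι}

theorem IsCrossing.apply_min (h : IsCrossing T x₁ x₂ t) :
    T (min t.1 t.2) = x₁ ∨ T (min t.1 t.2) = x₂ := by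
  rcases min_choice t.1 t.2 with e | e <;> rw [e]
  exacts [Or.inl h.2.1, Or.inr h.2.2.1]

theorem IsCrossing.apply_max (h : IsCrossing T x₁ x₂ t) :
    T (max t.1 t.2) = x₁ ∨ T (max t.1 t.2) = x₂ := by
  rcases max_choice t.1 t.2 with e | e <;> rw [e]
  exacts [Or.inl h.2.1, Or.inr h.2.2.1]

theorem IsCrossing.fst_ne_snd (h : IsCrossing T x₁ x₂ t) : t.1 ≠ t.2 := fun e =>
  h.1 (by rw [← h.2.1, e, h.2.2.1])

theorem IsCrossing.min_lt_max (h : IsCrossing T x₁ x₂ t) : min t.1 t.2 < max t.1 t.2 :=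
  _root_.min_lt_max.2 h.fst_ne_snd

/-- A time at which the path takes one of the two boundary values is not inside a crossing. -/
theorem IsCrossing.not_mem_of_apply (h : IsCrossing T x₁ x₂ t) {u : ι}
    (hu : T u = x₁ ∨ T u = x₂) : ¬(min t.1 t.2 < u ∧ u < max t.1 t.2) := fun ⟨h1, h2⟩ => by
  have := h.2.2.2 u h1 h2
  omega

/-- The path takes a boundary value at both ends of a crossing and never inside one, so neither
crossing can have an end inside the other. Overlapping crossings thus occupy the same time interval,
and the values at its ends fix the orientation. -/
theorem IsCrossing.eq_of_overlap (hs : IsCrossing T x₁ x₂ s) (ht : IsCrossing T x₁ x₂ t)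
    (h1 : min s.1 s.2 < max t.1 t.2) (h2 : min t.1 t.2 < max s.1 s.2) : s = t := by
  have hmin : min s.1 s.2 = min t.1 t.2 := by
    rcases lt_trichotomy (min s.1 s.2) (min t.1 t.2) with h | h | h
    · exact absurd ⟨h, h2⟩ (hs.not_mem_of_apply ht.apply_min)
    · exact h
    · exact absurd ⟨h, h1⟩ (ht.not_mem_of_apply hs.apply_min)
  have hmax : max s.1 s.2 = max t.1 t.2 := by
    rcases lt_trichotomy (max s.1 s.2) (max t.1 t.2) with h | h | h
    · exact absurd ⟨h2, h⟩ (ht.not_mem_of_apply hs.apply_max)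
    · exact h
    · exact absurd ⟨h1, h⟩ (hs.not_mem_of_apply ht.apply_max)
  have hne := hs.1
  have hs1 := hs.2.1
  have hs2 := hs.2.2.1
  have ht1 := ht.2.1
  have ht2 := ht.2.2.1
  rcases le_total s.1 s.2 with a | a <;> rcases le_total t.1 t.2 with b | b <;>
    simp only [a, b, min_eq_left, min_eq_right, max_eq_left, max_eq_right] at hmin hmax
  · exact Prod.ext hmin hmax
  · rw [← hmin] at ht2
    omega
  · rw [← hmin] at ht1
    omega
  · exact Prod.ext hmax hmin

theorem IsCrossing.eq_or_le_or_le (hs : IsCrossing T x₁ x₂ s) (ht : IsCrossing T x₁ x₂ t) :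
    s = t ∨ max s.1 s.2 ≤ min t.1 t.2 ∨ max t.1 t.2 ≤ min s.1 s.2 := by
  by_contra! h
  exact h.1 (hs.eq_of_overlap ht h.2.2 h.2.1)

end LinearOrder

theorem IsNearestNeighbor.exists_crossing {T : ℕ → ℤ} (hT : IsNearestNeighbor T) {x₁ x₂ : ℤ}
    (hx : x₁ ≠ x₂) (a b : ℕ) (ha : T a = x₁) (hb : T b = x₂) :
    ∃ s, IsCrossing T x₁ x₂ s ∧ s.1 ∈ Set.uIcc a b ∧ s.2 ∈ Set.uIcc a b := by
  induction hd : (max a b - min a b) using Nat.strong_induction_on generalizing a b with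
  | _ d ih =>
    by_cases h : ∀ s, min a b < s → s < max a b → min x₁ x₂ < T s ∧ T s < max x₁ x₂
    · exact ⟨(a, b), ⟨hx, ha, hb, h⟩, Set.left_mem_uIcc, Set.right_mem_uIcc⟩
    · push Not at h
      obtain ⟨c, hc1, hc2, hc3⟩ := h
      -- At time `c` the path is outside the open interval, on the side of `x₁` or of `x₂`. Between
      -- `c` and the opposite end it must then hit that boundary value, which yields a shorter pair
      -- of times.
      have key : x₁ ∈ Set.uIcc (T c) x₂ ∨ x₂ ∈ Set.uIcc x₁ (T c) := by
        simp only [Set.mem_uIcc]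
        omega
      rcases key with h | h
      · rw [← hb] at h
        obtain ⟨u, hu, hu'⟩ := hT.exists_eq h
        rw [Set.mem_uIcc] at hu
        obtain ⟨s, h1, h2, h3⟩ := ih (max u b - min u b) (by omega) u b hu' hb rfl
        rw [Set.mem_uIcc] at h2 h3
        exact ⟨s, h1, Set.mem_uIcc.2 (by omega), Set.mem_uIcc.2 (by omega)⟩
      · rw [← ha] at h
        obtain ⟨u, hu, hu'⟩ := hT.exists_eq h
        rw [Set.mem_uIcc] at hu
        obtain ⟨s, h1, h2, h3⟩ := ih (max a u - min a u) (by omega) a u ha hu' rfl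
        rw [Set.mem_uIcc] at h2 h3
        exact ⟨s, h1, Set.mem_uIcc.2 (by omega), Set.mem_uIcc.2 (by omega)⟩

/-! ### The crossing with a given number -/

/-- Distinct crossings are ordered in time. The later one has all predecessors of the earlier one
and the earlier one itself as predecessors, so its number is larger. -/
theorem IsNthCrossing.unique {T : ℕ → ℤ} {x₁ x₂ : ℤ} {i : ℕ} {s t : ℕ × ℕ}
    (hs : IsNthCrossing T x₁ x₂ i s) (ht : IsNthCrossing T x₁ x₂ i t) : s = t := by
  have key : ∀ {s t : ℕ × ℕ}, IsNthCrossing T x₁ x₂ i s → IsNthCrossing T x₁ x₂ i t →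
      ¬ max s.1 s.2 ≤ min t.1 t.2 := by
    intro s t hs ht h
    have hlt := hs.1.min_lt_max
    have hn : s ∉ {r : ℕ × ℕ | IsCrossing T x₁ x₂ r ∧ max r.1 r.2 ≤ min s.1 s.2} := by
      rintro ⟨-, h'⟩
      omega
    have hsub : insert s {r : ℕ × ℕ | IsCrossing T x₁ x₂ r ∧ max r.1 r.2 ≤ min s.1 s.2} ⊆
        {r : ℕ × ℕ | IsCrossing T x₁ x₂ r ∧ max r.1 r.2 ≤ min t.1 t.2} := by
      rintro r (rfl | ⟨h1, h2⟩)
      · exact ⟨hs.1, h⟩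
      · exact ⟨h1, by omega⟩
    have h1 := Set.encard_le_encard hsub
    rw [Set.encard_insert_of_notMem hn, hs.2] at h1
    have h2 := ht.2
    have h3 : (i : ℕ∞) + 1 ≤ i := by
      rw [← h2]
      gcongr
      rw [h2]
      exact h1
    have : i + 1 ≤ i := by exact_mod_cast h3
    omega
  rcases hs.1.eq_or_le_or_le ht.1 with h | h | h
  · exact h
  · exact absurd h (key hs ht)
  · exact absurd h (key ht hs)

theorem IsNthCrossing.index_unique {T : ℕ → ℤ} {x₁ x₂ : ℤ} {i j : ℕ} {t : ℕ × ℕ}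
    (hi : IsNthCrossing T x₁ x₂ i t) (hj : IsNthCrossing T x₁ x₂ j t) : i = j := by
  exact_mod_cast hi.2.symm.trans hj.2

/-- The path `T` visits every integer at arbitrarily late times. -/
def IsRecurrent (T : ℕ → ℤ) : Prop := ∀ (x : ℤ) (N : ℕ), ∃ k, N ≤ k ∧ T k = x

theorem IsNearestNeighbor.exists_isNthCrossing {T : ℕ → ℤ} (hT : IsNearestNeighbor T)
    (hr : IsRecurrent T) {x₁ x₂ : ℤ} (hx : x₁ ≠ x₂) (i : ℕ) :
    ∃ t, IsNthCrossing T x₁ x₂ (i + 1) t := by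
  have hnext : ∀ N : ℕ, ∃ t, IsCrossing T x₁ x₂ t ∧ N ≤ min t.1 t.2 ∧
      ∀ r, IsCrossing T x₁ x₂ r → N ≤ min r.1 r.2 → ¬ max r.1 r.2 ≤ min t.1 t.2 := by
    intro N
    -- The next crossing after time `N` is the one that ends earliest; recurrence provides at least
    -- one.
    have hex : ∃ d : ℕ, ∃ t, IsCrossing T x₁ x₂ t ∧ N ≤ min t.1 t.2 ∧ max t.1 t.2 = d := by
      obtain ⟨a, ha, ha'⟩ := hr x₁ N
      obtain ⟨b, hb, hb'⟩ := hr x₂ N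
      obtain ⟨s, hs, h1, h2⟩ := hT.exists_crossing hx a b ha' hb'
      rw [Set.mem_uIcc] at h1 h2
      exact ⟨_, s, hs, by omega, rfl⟩
    classical
    obtain ⟨t, h1, h2, h3⟩ := Nat.find_spec hex
    refine ⟨t, h1, h2, fun r hr1 hr2 hle => ?_⟩
    have := Nat.find_min' hex ⟨r, hr1, hr2, rfl⟩
    have := h1.min_lt_max
    omega
  induction i with
  | zero =>
    obtain ⟨t, h1, -, h3⟩ := hnext 0
    refine ⟨t, h1, ?_⟩
    have : {s : ℕ × ℕ | IsCrossing T x₁ x₂ s ∧ max s.1 s.2 ≤ min t.1 t.2} = ∅ := by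
      ext s
      simpa using fun hs => by simpa using h3 s hs (Nat.zero_le _)
    rw [this]
    simp
  | succ i ih =>
    obtain ⟨s, hs⟩ := ih
    obtain ⟨t, h1, h2, h3⟩ := hnext (max s.1 s.2)
    refine ⟨t, h1, ?_⟩
    have hlt := hs.1.min_lt_max
    have hn : s ∉ {r : ℕ × ℕ | IsCrossing T x₁ x₂ r ∧ max r.1 r.2 ≤ min s.1 s.2} := by
      rintro ⟨-, h'⟩
      omega
    have : {r : ℕ × ℕ | IsCrossing T x₁ x₂ r ∧ max r.1 r.2 ≤ min t.1 t.2} =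
        insert s {r : ℕ × ℕ | IsCrossing T x₁ x₂ r ∧ max r.1 r.2 ≤ min s.1 s.2} := by
      ext r
      constructor
      · rintro ⟨hr1, hr2⟩
        rcases hr1.eq_or_le_or_le hs.1 with h | h | h
        · exact Or.inl h
        · exact Or.inr ⟨hr1, h⟩
        · exact absurd hr2 (h3 r hr1 h)
      · rintro (rfl | ⟨hr1, hr2⟩)
        · exact ⟨hs.1, h2⟩
        · exact ⟨hr1, by omega⟩
    rw [this, Set.encard_insert_of_notMem hn, hs.2]
    push_cast
    rfl

/-! ### The first crossing during a time interval -/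

/-- Distance to `t₁` is replaced by betweenness because the latter is preserved by every strictly
increasing change of time, in particular by deleting times. -/
theorem mem_uIcc_iff_abs_sub_le {a b r s : ℕ} (hs : s ∈ Set.uIcc a b) (hr : r ∈ Set.uIcc a b) :
    |(s : ℤ) - a| ≤ |(r : ℤ) - a| ↔ s ∈ Set.uIcc a r := by
  simp only [Set.mem_uIcc, abs_eq_max_neg] at *
  omega

/-- The first crossing in terms of the order of the times only. -/
theorem isFirstCrossingDuring_iff {T : ℕ → ℤ} {x₁ x₂ : ℤ} {t s : ℕ × ℕ} :
    IsFirstCrossingDuring T x₁ x₂ t s ↔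
      IsCrossing T x₁ x₂ s ∧ s.1 ∈ Set.uIcc t.1 t.2 ∧ s.2 ∈ Set.uIcc t.1 t.2 ∧
        ∀ r : ℕ × ℕ, IsCrossing T x₁ x₂ r → r.1 ∈ Set.uIcc t.1 t.2 → r.2 ∈ Set.uIcc t.1 t.2 →
          s.1 ∈ Set.uIcc t.1 r.1 ∧ s.2 ∈ Set.uIcc t.1 r.2 := by
  unfold IsFirstCrossingDuring
  refine and_congr_right fun _ => and_congr_right fun h1 => and_congr_right fun h2 => ?_
  refine forall_congr' fun r => imp_congr_right fun _ => imp_congr_right fun h3 =>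
    imp_congr_right fun h4 => ?_
  rw [mem_uIcc_iff_abs_sub_le h1 h3, mem_uIcc_iff_abs_sub_le h2 h4]

theorem IsFirstCrossingDuring.unique {T : ℕ → ℤ} {x₁ x₂ : ℤ} {t s r : ℕ × ℕ}
    (hs : IsFirstCrossingDuring T x₁ x₂ t s) (hr : IsFirstCrossingDuring T x₁ x₂ t r) : s = r := by
  rw [isFirstCrossingDuring_iff] at hs hr
  obtain ⟨a1, a2, a3, a4⟩ := hs
  obtain ⟨b1, b2, b3, b4⟩ := hr
  have h1 := a4 r b1 b2 b3
  have h2 := b4 s a1 a2 a3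
  simp only [Set.mem_uIcc] at *
  ext <;> omega

theorem IsNearestNeighbor.exists_isFirstCrossingDuring {T : ℕ → ℤ} (hT : IsNearestNeighbor T)
    {x₁ x₂ : ℤ} (hx : x₁ ≠ x₂) {t : ℕ × ℕ} (h₁ : x₁ ∈ Set.uIcc (T t.1) (T t.2))
    (h₂ : x₂ ∈ Set.uIcc (T t.1) (T t.2)) : ∃ s, IsFirstCrossingDuring T x₁ x₂ t s := by
  obtain ⟨a, ha, ha'⟩ := hT.exists_eq h₁
  obtain ⟨b, hb, hb'⟩ := hT.exists_eq h₂
  obtain ⟨s₀, hs₀, h3, h4⟩ := hT.exists_crossing hx a b ha' hb'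
  -- The crossing minimizing the sum of the distances of its two times to `t.1` is closest in both
  -- times, since different crossings do not overlap.
  have hex : ∃ d : ℕ, ∃ s, (IsCrossing T x₁ x₂ s ∧ s.1 ∈ Set.uIcc t.1 t.2 ∧
      s.2 ∈ Set.uIcc t.1 t.2) ∧ (max s.1 t.1 - min s.1 t.1) + (max s.2 t.1 - min s.2 t.1) = d := by
    refine ⟨_, s₀, ⟨hs₀, ?_, ?_⟩, rfl⟩ <;>
    · simp only [Set.mem_uIcc] at *
      omega
  classical
  obtain ⟨s, ⟨h5, h6, h7⟩, h8⟩ := Nat.find_spec hex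
  refine ⟨s, isFirstCrossingDuring_iff.2 ⟨h5, h6, h7, fun r h9 h10 h11 => ?_⟩⟩
  have h12 := Nat.find_min' hex ⟨r, ⟨h9, h10, h11⟩, rfl⟩
  rw [← h8] at h12
  have h13 := h5.min_lt_max
  have h14 := h9.min_lt_max
  have h15 := h5.eq_or_le_or_le h9
  clear h8 h3 h4 ha hb h₁ h₂
  rcases h15 with rfl | h
  · exact ⟨Set.right_mem_uIcc, Set.right_mem_uIcc⟩
  · rcases le_total t.1 t.2 with ht | ht
    · rw [Set.uIcc_of_le ht, Set.mem_Icc] at h6 h7 h10 h11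
      rw [Set.mem_uIcc, Set.mem_uIcc]
      rcases h with h | h <;> constructor <;> omega
    · rw [Set.uIcc_of_ge ht, Set.mem_Icc] at h6 h7 h10 h11
      rw [Set.mem_uIcc, Set.mem_uIcc]
      rcases h with h | h <;> constructor <;> omega

/-- If `(x₁, x₂)` has the same orientation as the values of `T` at the ends of `t`, then the first
crossing of `(x₁, x₂)` during `t` ends with the first visit of `x₂`. -/
theorem IsFirstCrossingDuring.eq_snd_of_apply_eq {T : ℕ → ℤ} (hT : IsNearestNeighbor T)
    {x₁ x₂ : ℤ} {t s : ℕ × ℕ} (hs : IsFirstCrossingDuring T x₁ x₂ t s)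
    (h₁ : x₁ ∈ Set.uIcc (T t.1) x₂) :
    s.1 ∈ Set.uIcc t.1 s.2 ∧ ∀ u ∈ Set.uIcc t.1 s.2, T u = x₂ → u = s.2 := by
  rw [isFirstCrossingDuring_iff] at hs
  obtain ⟨a1, a2, a3, a4⟩ := hs
  -- A visit of `x₂` at time `u` forces a visit of `x₁` between `t.1` and `u`, hence a whole
  -- crossing there; the first crossing cannot end later than that one.
  have key : ∀ u ∈ Set.uIcc t.1 s.2, T u = x₂ → s.1 ∈ Set.uIcc t.1 u ∧ u = s.2 := by
    intro u hu hux
    rw [← hux] at h₁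
    obtain ⟨a, ha, ha'⟩ := hT.exists_eq h₁
    obtain ⟨r, hr, h3, h4⟩ := hT.exists_crossing a1.1 a u ha' hux
    have h5 := a4 r hr (by simp only [Set.mem_uIcc] at *; omega)
      (by simp only [Set.mem_uIcc] at *; omega)
    clear a4 h₁
    simp only [Set.mem_uIcc] at *
    rcases le_total t.1 t.2 with h | h <;> omega
  exact ⟨(key s.2 Set.right_mem_uIcc a1.2.2.1).1, fun u hu hux => (key u hu hux).2⟩

/-! ### Deleting a backtrack from a path -/

/-- The increasing enumeration of all times except `a + 2` and `a + 3`. -/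
def skipTwo (a t : ℕ) : ℕ := if t ≤ a + 1 then t else t + 2

theorem skipTwo_strictMono (a : ℕ) : StrictMono (skipTwo a) := fun s t h => by
  unfold skipTwo
  split_ifs <;> omega

theorem skipTwo_of_le {a t : ℕ} (h : t ≤ a + 1) : skipTwo a t = t := if_pos h

theorem skipTwo_of_lt {a t : ℕ} (h : a + 1 < t) : skipTwo a t = t + 2 := if_neg (by omega)

theorem exists_skipTwo_eq {a u : ℕ} (h2 : u ≠ a + 2) (h3 : u ≠ a + 3) : ∃ v, skipTwo a v = u := by
  rcases le_or_gt u (a + 1) with h | h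
  · exact ⟨u, skipTwo_of_le h⟩
  · exact ⟨u - 2, by rw [skipTwo_of_lt (by omega)]; omega⟩

theorem skipTwo_min (a s t : ℕ) : skipTwo a (min s t) = min (skipTwo a s) (skipTwo a t) :=
  (skipTwo_strictMono a).monotone.map_min

theorem skipTwo_max (a s t : ℕ) : skipTwo a (max s t) = max (skipTwo a s) (skipTwo a t) :=
  (skipTwo_strictMono a).monotone.map_max

theorem skipTwo_mem_uIcc {a s t r : ℕ} :
    skipTwo a s ∈ Set.uIcc (skipTwo a t) (skipTwo a r) ↔ s ∈ Set.uIcc t r := by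
  simp only [Set.mem_uIcc, (skipTwo_strictMono a).le_iff_le]

theorem prodMap_skipTwo_injective (a : ℕ) :
    Function.Injective (Prod.map (skipTwo a) (skipTwo a)) :=
  (skipTwo_strictMono a).injective.prodMap (skipTwo_strictMono a).injective

/-- The path `T` takes the values `p, q, p` at the times `a + 1, a + 2, a + 3`. -/
structure HasBacktrack (T : ℕ → ℤ) (a : ℕ) (p q : ℤ) : Prop where
  one : T (a + 1) = p
  two : T (a + 2) = q
  three : T (a + 3) = p
  adj : q = p + 1 ∨ q = p - 1

section Backtrack

variable {T : ℕ → ℤ} {a : ℕ} {p q x₁ x₂ : ℤ} {t s : ℕ × ℕ}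

/-- The deleted times carry the values `q` and `p`, neither of which is a boundary value. A crossing
spanning them also contains time `a + 1`, where the path is at `p`; so `p` is strictly inside, and
so is its neighbor `q`. -/
theorem HasBacktrack.isCrossing_iff (hb : HasBacktrack T a p q) (h₁ : x₁ ≠ p ∧ x₁ ≠ q)
    (h₂ : x₂ ≠ p ∧ x₂ ≠ q) :
    IsCrossing (T ∘ skipTwo a) x₁ x₂ t ↔ IsCrossing T x₁ x₂ (Prod.map (skipTwo a) (skipTwo a) t) := by
  have hmono := skipTwo_strictMono a
  unfold IsCrossing
  simp only [Function.comp_apply, Prod.map_fst, Prod.map_snd, ← skipTwo_min, ← skipTwo_max]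
  refine and_congr_right fun hx => and_congr_right fun e1 => and_congr_right fun e2 => ?_
  constructor
  · intro h s hs1 hs2
    by_cases hs : s = a + 2 ∨ s = a + 3
    · have hlo : min t.1 t.2 ≤ a + 1 := by
        by_contra hc
        rw [skipTwo_of_lt (by omega)] at hs1
        omega
      have hhi : a + 1 < max t.1 t.2 := by
        by_contra hc
        rw [skipTwo_of_le (by omega)] at hs2
        omega
      have hne : min t.1 t.2 ≠ a + 1 := by
        intro hc
        rcases min_choice t.1 t.2 with e | e <;> rw [e] at hc
        · rw [hc, skipTwo_of_le le_rfl, hb.one] at e1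
          exact h₁.1 e1.symm
        · rw [hc, skipTwo_of_le le_rfl, hb.one] at e2
          exact h₂.1 e2.symm
      have := h (a + 1) (by omega) hhi
      rw [skipTwo_of_le le_rfl, hb.one] at this
      have hadj := hb.adj
      rcases hs with rfl | rfl
      · rw [hb.two]
        omega
      · rw [hb.three]
        exact this
    · obtain ⟨v, rfl⟩ := exists_skipTwo_eq (a := a) (u := s) (by omega) (by omega)
      exact h v (hmono.lt_iff_lt.1 hs1) (hmono.lt_iff_lt.1 hs2)
  · exact fun h s hs1 hs2 => h _ (hmono.lt_iff_lt.2 hs1) (hmono.lt_iff_lt.2 hs2)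

theorem HasBacktrack.exists_eq_skipTwo (hb : HasBacktrack T a p q) {u : ℕ}
    (hu : T u ≠ p ∧ T u ≠ q) : ∃ v, skipTwo a v = u := by
  refine exists_skipTwo_eq ?_ ?_
  · rintro rfl
    exact hu.2 hb.two
  · rintro rfl
    exact hu.1 hb.three

theorem HasBacktrack.exists_of_isCrossing (hb : HasBacktrack T a p q) (h₁ : x₁ ≠ p ∧ x₁ ≠ q)
    (h₂ : x₂ ≠ p ∧ x₂ ≠ q) (ht : IsCrossing T x₁ x₂ t) :
    ∃ t', Prod.map (skipTwo a) (skipTwo a) t' = t := by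
  obtain ⟨u, hu⟩ := hb.exists_eq_skipTwo (u := t.1) (by rwa [ht.2.1])
  obtain ⟨v, hv⟩ := hb.exists_eq_skipTwo (u := t.2) (by rwa [ht.2.2.1])
  exact ⟨(u, v), Prod.ext hu hv⟩

/-- No crossing starts or ends at a deleted time, so `skipTwo` maps the earlier crossings of the
shortened path bijectively onto those of `T`, and the count is unchanged. -/
theorem HasBacktrack.isNthCrossing_iff (hb : HasBacktrack T a p q) (h₁ : x₁ ≠ p ∧ x₁ ≠ q)
    (h₂ : x₂ ≠ p ∧ x₂ ≠ q) {i : ℕ} :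
    IsNthCrossing (T ∘ skipTwo a) x₁ x₂ i t ↔
      IsNthCrossing T x₁ x₂ i (Prod.map (skipTwo a) (skipTwo a) t) := by
  unfold IsNthCrossing
  rw [hb.isCrossing_iff h₁ h₂]
  have hset : {s : ℕ × ℕ | IsCrossing T x₁ x₂ s ∧ max s.1 s.2 ≤
      min (Prod.map (skipTwo a) (skipTwo a) t).1 (Prod.map (skipTwo a) (skipTwo a) t).2} =
      Prod.map (skipTwo a) (skipTwo a) ''
        {s : ℕ × ℕ | IsCrossing (T ∘ skipTwo a) x₁ x₂ s ∧ max s.1 s.2 ≤ min t.1 t.2} := by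
    ext s
    simp only [Prod.map_fst, Prod.map_snd, ← skipTwo_min, Set.mem_image, Set.mem_ofPred_eq]
    constructor
    · rintro ⟨h3, h4⟩
      obtain ⟨s', rfl⟩ := hb.exists_of_isCrossing h₁ h₂ h3
      rw [Prod.map_fst, Prod.map_snd, ← skipTwo_max, (skipTwo_strictMono a).le_iff_le] at h4
      exact ⟨s', ⟨(hb.isCrossing_iff h₁ h₂).2 h3, h4⟩, rfl⟩
    · rintro ⟨s', ⟨h3, h4⟩, rfl⟩
      refine ⟨(hb.isCrossing_iff h₁ h₂).1 h3, ?_⟩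
      rwa [Prod.map_fst, Prod.map_snd, ← skipTwo_max, (skipTwo_strictMono a).le_iff_le]
  rw [hset, (prodMap_skipTwo_injective a).encard_image]

theorem HasBacktrack.isFirstCrossingDuring_iff (hb : HasBacktrack T a p q)
    (h₁ : x₁ ≠ p ∧ x₁ ≠ q) (h₂ : x₂ ≠ p ∧ x₂ ≠ q) :
    IsFirstCrossingDuring (T ∘ skipTwo a) x₁ x₂ t s ↔
      IsFirstCrossingDuring T x₁ x₂ (Prod.map (skipTwo a) (skipTwo a) t)
        (Prod.map (skipTwo a) (skipTwo a) s) := by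
  simp only [_root_.isFirstCrossingDuring_iff, Prod.map_fst, Prod.map_snd, skipTwo_mem_uIcc]
  rw [hb.isCrossing_iff h₁ h₂]
  refine and_congr_right fun _ => and_congr_right fun _ => and_congr_right fun _ => ?_
  constructor
  · intro h r hr h3 h4
    obtain ⟨r, rfl⟩ := hb.exists_of_isCrossing h₁ h₂ hr
    simp only [Prod.map_fst, Prod.map_snd, skipTwo_mem_uIcc] at *
    exact h r ((hb.isCrossing_iff h₁ h₂).2 hr) h3 h4
  · intro h r hr h3 h4
    have := h (Prod.map (skipTwo a) (skipTwo a) r) ((hb.isCrossing_iff h₁ h₂).1 hr)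
    simp only [Prod.map_fst, Prod.map_snd, skipTwo_mem_uIcc] at this
    exact this h3 h4

end Backtrack

/-! ### Loci -/

/-- The data `k₁, k₂, i, j₁, j₂` of a locus of a path: the first crossing of `(j₁, j₂)` during the
`i`-th crossing of `(k₁, k₂)`. -/
structure LocusLabel where
  k₁ : ℤ
  k₂ : ℤ
  i : ℕ
  j₁ : ℤ
  j₂ : ℤ

/-- `s` is the first crossing by `T` of `(j₁, j₂)` during the `i`-th crossing of `(k₁, k₂)`. -/
def IsLocus (T : ℕ → ℤ) (l : LocusLabel) (s : ℕ × ℕ) : Prop :=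
  ∃ t, IsNthCrossing T l.k₁ l.k₂ l.i t ∧ IsFirstCrossingDuring T l.j₁ l.j₂ t s

/-- The locus of `T` with label `l` exists and is a straight crossing. -/
def IsStraightLocus (T : ℕ → ℤ) (l : LocusLabel) : Prop :=
  ∃ s, IsLocus T l s ∧ |(s.1 : ℤ) - s.2| = |l.j₁ - l.j₂|

namespace LocusLabel

/-- `x` is not an inner point of the interval `(j₁, j₂)`. -/
def Avoids (l : LocusLabel) (x : ℤ) : Prop := ¬(min l.j₁ l.j₂ < x ∧ x < max l.j₁ l.j₂)

/-- None of the endpoints of `l'` is an inner point of the interval `(j₁, j₂)` of `l`. -/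
def AvoidsAll (l l' : LocusLabel) : Prop :=
  l.Avoids l'.k₁ ∧ l.Avoids l'.k₂ ∧ l.Avoids l'.j₁ ∧ l.Avoids l'.j₂

/-- The intervals `(j₁, j₂)` of the two labels have no common inner point, or the labels differ in
the number `i` only. -/
def Separated (l l' : LocusLabel) : Prop :=
  (∀ x, l.Avoids x ∨ l'.Avoids x) ∨
    (l.k₁ = l'.k₁ ∧ l.k₂ = l'.k₂ ∧ l.i ≠ l'.i ∧ l.j₁ = l'.j₁ ∧ l.j₂ = l'.j₂)

/-- The lower endpoint of `(j₁, j₂)` if `up`, and the upper one otherwise. -/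
def start (l : LocusLabel) (up : Bool) : ℤ := if up then min l.j₁ l.j₂ else max l.j₁ l.j₂

end LocusLabel

/-- The step `1` or `-1`. -/
def signStep (up : Bool) : ℤ := if up then 1 else -1

/-- The locus of `T` with label `l` begins at time `a`, upwards or downwards. -/
def LocusBegins (T : ℕ → ℤ) (l : LocusLabel) (a : ℕ) (up : Bool) : Prop :=
  T a = l.start up ∧ ∃ s, IsLocus T l s ∧ min s.1 s.2 = a

theorem IsLocus.unique {T : ℕ → ℤ} {l : LocusLabel} {s r : ℕ × ℕ} (hs : IsLocus T l s)
    (hr : IsLocus T l r) : s = r := by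
  obtain ⟨t, h1, h2⟩ := hs
  obtain ⟨t', h1', h2'⟩ := hr
  obtain rfl := h1.unique h1'
  exact h2.unique h2'

theorem IsLocus.isCrossing {T : ℕ → ℤ} {l : LocusLabel} {s : ℕ × ℕ} (hs : IsLocus T l s) :
    IsCrossing T l.j₁ l.j₂ s := by
  obtain ⟨t, -, h⟩ := hs
  exact h.1

theorem exists_isLocus {T : ℕ → ℤ} (hT : IsNearestNeighbor T) (hr : IsRecurrent T)
    {l : LocusLabel} (hi : 0 < l.i) (hj : l.j₁ ≠ l.j₂) (hk : l.k₁ ≠ l.k₂)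
    (h1 : l.j₁ ∈ Set.uIcc l.k₁ l.k₂) (h2 : l.j₂ ∈ Set.uIcc l.k₁ l.k₂) : ∃ s, IsLocus T l s := by
  obtain ⟨t, ht⟩ := hT.exists_isNthCrossing hr hk (l.i - 1)
  rw [Nat.sub_add_cancel hi] at ht
  obtain ⟨s, hs⟩ := hT.exists_isFirstCrossingDuring (t := t) hj
    (by rwa [ht.1.2.1, ht.1.2.2.1]) (by rwa [ht.1.2.1, ht.1.2.2.1])
  exact ⟨s, t, ht, hs⟩

theorem IsLocus.exists_locusBegins {T : ℕ → ℤ} {l : LocusLabel} {s : ℕ × ℕ} (hs : IsLocus T l s) :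
    ∃ a up, LocusBegins T l a up := by
  have h := hs.isCrossing.apply_min
  refine ⟨min s.1 s.2, decide (T (min s.1 s.2) = min l.j₁ l.j₂), ?_, s, hs, rfl⟩
  unfold LocusLabel.start
  by_cases e : T (min s.1 s.2) = min l.j₁ l.j₂
  · simp [e]
  · simp only [e, decide_false, Bool.false_eq_true, if_false]
    omega

/-- This makes the events indexed by the starting time and direction disjoint, so that probabilities
can be summed over them. -/
theorem LocusBegins.unique {T : ℕ → ℤ} {l : LocusLabel} {a b : ℕ} {up up' : Bool}
    (hj : l.j₁ ≠ l.j₂) (h : LocusBegins T l a up) (h' : LocusBegins T l b up') :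
    a = b ∧ up = up' := by
  obtain ⟨h1, s, h2, rfl⟩ := h
  obtain ⟨h1', s', h2', rfl⟩ := h'
  obtain rfl := h2.unique h2'
  refine ⟨rfl, ?_⟩
  have := h1.symm.trans h1'
  unfold LocusLabel.start at this
  cases up <;> cases up' <;> simp at this ⊢ <;> omega

theorem HasBacktrack.isLocus_iff {T : ℕ → ℤ} {a : ℕ} {p q : ℤ} (hb : HasBacktrack T a p q)
    {l l' : LocusLabel} (hp : ¬ l.Avoids p) (hq : ¬ l.Avoids q) (hl : l.AvoidsAll l')
    {s : ℕ × ℕ} :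
    IsLocus (T ∘ skipTwo a) l' s ↔ IsLocus T l' (Prod.map (skipTwo a) (skipTwo a) s) := by
  have key : ∀ {x}, l.Avoids x → x ≠ p ∧ x ≠ q := fun hx =>
    ⟨fun e => hp (e ▸ hx), fun e => hq (e ▸ hx)⟩
  obtain ⟨h1, h2, h3, h4⟩ := hl
  constructor
  · rintro ⟨t, ht, hs⟩
    exact ⟨_, (hb.isNthCrossing_iff (key h1) (key h2)).1 ht,
      (hb.isFirstCrossingDuring_iff (key h3) (key h4)).1 hs⟩
  · rintro ⟨t, ht, hs⟩
    obtain ⟨t, rfl⟩ := hb.exists_of_isCrossing (key h1) (key h2) ht.1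
    exact ⟨_, (hb.isNthCrossing_iff (key h1) (key h2)).2 ht,
      (hb.isFirstCrossingDuring_iff (key h3) (key h4)).2 hs⟩

theorem HasBacktrack.exists_of_isLocus {T : ℕ → ℤ} {a : ℕ} {p q : ℤ} (hb : HasBacktrack T a p q)
    {l l' : LocusLabel} (hp : ¬ l.Avoids p) (hq : ¬ l.Avoids q) (hl : l.AvoidsAll l')
    {s : ℕ × ℕ} (hs : IsLocus T l' s) :
    ∃ s', Prod.map (skipTwo a) (skipTwo a) s' = s ∧ IsLocus (T ∘ skipTwo a) l' s' := by
  have key : ∀ {x}, l.Avoids x → x ≠ p ∧ x ≠ q := fun hx =>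
    ⟨fun e => hp (e ▸ hx), fun e => hq (e ▸ hx)⟩
  obtain ⟨s', rfl⟩ := hb.exists_of_isCrossing (key hl.2.2.1) (key hl.2.2.2) hs.isCrossing
  exact ⟨s', rfl, (hb.isLocus_iff hp hq hl).2 hs⟩

/-- The path makes a step and takes it back at the times `a + 1, a + 2, a + 3`. -/
def StepsBack (T : ℕ → ℤ) (a : ℕ) (up : Bool) : Prop :=
  T (a + 2) - T (a + 1) = signStep up ∧ T (a + 3) - T (a + 2) = -signStep up

/-- The first two steps of a crossing of an interval of length three. -/
theorem LocusBegins.apply_add_one {T : ℕ → ℤ} (hT : IsNearestNeighbor T) {l : LocusLabel}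
    (hl : |l.j₁ - l.j₂| = 3) {a : ℕ} {up : Bool} (h : LocusBegins T l a up) :
    T (a + 1) = l.start up + signStep up := by
  obtain ⟨h1, s, h2, rfl⟩ := h
  have hc := h2.isCrossing
  have hlen := hT.abs_sub_le s.1 s.2
  rw [hc.2.1, hc.2.2.1, hl] at hlen
  have h3 := hc.2.2.2 (min s.1 s.2 + 1) (by omega) (by rw [abs_eq_max_neg] at hlen; omega)
  have h4 := hT (min s.1 s.2)
  unfold LocusLabel.start at h1 ⊢
  unfold signStep
  rw [abs_eq_max_neg] at hl
  cases up <;> simp at h1 ⊢ <;> omega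

/-- A crossing that is not straight is still strictly inside the interval at the times `a + 2` and
`a + 3`. With just two inner points available, the path has to go to the far one and come back. -/
theorem IsNearestNeighbor.stepsBack {T : ℕ → ℤ} (hT : IsNearestNeighbor T) {l : LocusLabel}
    (hl : |l.j₁ - l.j₂| = 3) {a : ℕ} {up : Bool} (h : LocusBegins T l a up)
    (hs : ¬ IsStraightLocus T l) : StepsBack T a up := by
  have h0 := h.apply_add_one hT hl
  obtain ⟨h1, s, h2, ha⟩ := h
  have hne : |(s.1 : ℤ) - s.2| ≠ |l.j₁ - l.j₂| := fun e => hs ⟨s, h2, e⟩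
  have hc := h2.isCrossing
  have hlen := hT.abs_sub_le s.1 s.2
  rw [hc.2.1, hc.2.2.1] at hlen
  have hmax : a + 3 < max s.1 s.2 := by
    rw [hl, abs_eq_max_neg] at hne hlen
    omega
  have h3 := hc.2.2.2 (a + 2) (by omega) (by omega)
  have h4 := hc.2.2.2 (a + 3) (by omega) (by omega)
  have h5 : T (a + 2) = T (a + 1) + 1 ∨ T (a + 2) = T (a + 1) - 1 := hT (a + 1)
  have h6 : T (a + 3) = T (a + 2) + 1 ∨ T (a + 3) = T (a + 2) - 1 := hT (a + 2)
  unfold StepsBack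
  unfold LocusLabel.start at h0
  unfold signStep at h0 ⊢
  rw [abs_eq_max_neg] at hl
  cases up <;> simp at h0 ⊢ <;> omega

theorem LocusLabel.not_avoids_start {l : LocusLabel} (hl : |l.j₁ - l.j₂| = 3) (up : Bool) :
    ¬ l.Avoids (l.start up + signStep up) ∧ ¬ l.Avoids (l.start up + 2 * signStep up) := by
  unfold Avoids start signStep
  rw [abs_eq_max_neg] at hl
  cases up <;> simp <;> omega

theorem StepsBack.hasBacktrack {T : ℕ → ℤ} {a : ℕ} {up : Bool} {l : LocusLabel}
    (h : StepsBack T a up) (h1 : T (a + 1) = l.start up + signStep up) :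
    HasBacktrack T a (l.start up + signStep up) (l.start up + 2 * signStep up) := by
  obtain ⟨h2, h3⟩ := h
  refine ⟨h1, by linarith, by linarith, ?_⟩
  unfold signStep
  cases up <;> simp <;> omega

/-- A locus which is not straight and begins at time `a` is obtained by inserting a backtrack. -/
theorem IsNearestNeighbor.locusBegins_and_not_isStraightLocus_iff {T : ℕ → ℤ}
    (hT : IsNearestNeighbor T) {l : LocusLabel} (hl : |l.j₁ - l.j₂| = 3) (hself : l.AvoidsAll l)
    {a : ℕ} {up : Bool} (hT' : StepsBack T a up → IsNearestNeighbor (T ∘ skipTwo a)) :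
    LocusBegins T l a up ∧ ¬ IsStraightLocus T l ↔
      StepsBack T a up ∧ LocusBegins (T ∘ skipTwo a) l a up := by
  have hn := LocusLabel.not_avoids_start hl up
  constructor
  · rintro ⟨h1, h2⟩
    have h3 := hT.stepsBack hl h1 h2
    refine ⟨h3, ?_⟩
    have hb := h3.hasBacktrack (h1.apply_add_one hT hl)
    obtain ⟨h4, s, h5, h6⟩ := h1
    obtain ⟨s', rfl, hs'⟩ := hb.exists_of_isLocus hn.1 hn.2 hself h5
    refine ⟨by rw [Function.comp_apply, skipTwo_of_le (by omega)]; exact h4, s', hs', ?_⟩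
    rw [Prod.map_fst, Prod.map_snd, ← skipTwo_min] at h6
    rw [← (skipTwo_strictMono a).injective.eq_iff, h6, skipTwo_of_le (by omega)]
  · rintro ⟨h1, h2⟩
    have h3 := h2.apply_add_one (hT' h1) hl
    rw [Function.comp_apply, skipTwo_of_le le_rfl] at h3
    have hb := h1.hasBacktrack h3
    obtain ⟨h4, s, h5, h6⟩ := h2
    have h7 := (hb.isLocus_iff hn.1 hn.2 hself).1 h5
    rw [Function.comp_apply, skipTwo_of_le (by omega)] at h4
    refine ⟨⟨h4, _, h7, ?_⟩, ?_⟩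
    · rw [Prod.map_fst, Prod.map_snd, ← skipTwo_min, h6, skipTwo_of_le (by omega)]
    · rintro ⟨r, hr, hr'⟩
      obtain rfl := hr.unique h7
      -- In the shortened path the locus begins at `a` and lasts at least three steps, so it spans
      -- the gap after `a + 1`; reinserting the backtrack makes it last at least five.
      have h8 := (hT' h1).abs_sub_le s.1 s.2
      rw [h5.isCrossing.2.1, h5.isCrossing.2.2.1] at h8
      rw [hl] at hr' h8
      rw [Prod.map_fst, Prod.map_snd] at hr'
      unfold skipTwo at hr'
      rw [abs_eq_max_neg] at hr' h8
      split_ifs at hr' <;> omega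

/-- Deleting a backtrack from one locus does not change whether another locus is straight. -/
theorem StepsBack.isStraightLocus_iff {T : ℕ → ℤ} {l l' : LocusLabel} (hl : |l.j₁ - l.j₂| = 3)
    (hl' : l.AvoidsAll l') (hsep : l.Separated l') {a : ℕ} {up : Bool}
    (hT' : IsNearestNeighbor (T ∘ skipTwo a)) (h1 : StepsBack T a up)
    (h2 : LocusBegins (T ∘ skipTwo a) l a up) :
    IsStraightLocus T l' ↔ IsStraightLocus (T ∘ skipTwo a) l' := by
  have hn := LocusLabel.not_avoids_start hl up
  have h3 := h2.apply_add_one hT' hl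
  have h3' := h3
  rw [Function.comp_apply, skipTwo_of_le le_rfl] at h3
  have hb := h1.hasBacktrack h3
  have key : ∀ s, IsLocus (T ∘ skipTwo a) l' s →
      |((Prod.map (skipTwo a) (skipTwo a) s).1 : ℤ) - (Prod.map (skipTwo a) (skipTwo a) s).2| =
        |(s.1 : ℤ) - s.2| := by
    intro s hs
    -- The duration can change only if the other locus spans the gap. Then the inner point visited
    -- at `a + 1` belongs to both intervals, so the labels differ only in `i`. Both loci are then
    -- the same crossing, and the surrounding crossings overlap and coincide, which contradicts
    -- their different numbers.
    by_cases hin : min s.1 s.2 ≤ a + 1 ∧ a + 1 < max s.1 s.2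
    · exfalso
      have hc := hs.isCrossing
      have hlo : min s.1 s.2 < a + 1 := by
        refine lt_of_le_of_ne hin.1 fun e => ?_
        have h4 := hc.apply_min
        rw [e, h3'] at h4
        rcases h4 with h4 | h4
        · exact hn.1 (h4 ▸ hl'.2.2.1)
        · exact hn.1 (h4 ▸ hl'.2.2.2)
      have hpin := hc.2.2.2 (a + 1) hlo hin.2
      rw [h3'] at hpin
      rcases hsep with hsep | ⟨e1, e2, e3, e4, e5⟩
      · rcases hsep (l.start up + signStep up) with h | h
        · exact hn.1 h
        · exact h hpin
      · obtain ⟨-, r, hr, hra⟩ := h2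
        have hrc := hr.isCrossing
        have hrmax : a + 1 < max r.1 r.2 := by
          have := hT'.abs_sub_le r.1 r.2
          rw [hrc.2.1, hrc.2.2.1, hl, abs_eq_max_neg] at this
          omega
        rw [← e4, ← e5] at hc
        obtain rfl := hrc.eq_of_overlap hc (by omega) (by omega)
        obtain ⟨t, ht1, ht2⟩ := hr
        obtain ⟨t', ht1', ht2'⟩ := hs
        rw [← e1, ← e2] at ht1'
        have ha2 := ht2.2.1
        have ha3 := ht2.2.2.1
        have ha2' := ht2'.2.1
        have ha3' := ht2'.2.2.1
        rw [Set.mem_uIcc] at ha2 ha3 ha2' ha3'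
        obtain rfl := ht1.1.eq_of_overlap ht1'.1 (by omega) (by omega)
        exact e3 (ht1.index_unique ht1')
    · rw [Prod.map_fst, Prod.map_snd]
      unfold skipTwo
      rw [abs_eq_max_neg, abs_eq_max_neg]
      split_ifs <;> push_cast <;> omega
  constructor
  · rintro ⟨s, hs, hs'⟩
    obtain ⟨s', rfl, h4⟩ := hb.exists_of_isLocus hn.1 hn.2 hl' hs
    exact ⟨s', h4, by rw [← key s' h4, hs']⟩
  · rintro ⟨s, hs, hs'⟩
    exact ⟨_, (hb.isLocus_iff hn.1 hn.2 hl').1 hs, by rw [key s hs, hs']⟩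

/-- Deleting a backtrack from a nearest-neighbor path gives a nearest-neighbor path. -/
theorem StepsBack.isNearestNeighbor {T : ℕ → ℤ} (hT : IsNearestNeighbor T) {a : ℕ} {up : Bool}
    (h : StepsBack T a up) : IsNearestNeighbor (T ∘ skipTwo a) := by
  intro k
  obtain ⟨h1, h2⟩ := h
  simp only [Function.comp_apply]
  rcases lt_trichotomy k (a + 1) with hk | rfl | hk
  · rw [skipTwo_of_le (by omega), skipTwo_of_le (by omega)]
    exact hT k
  · rw [skipTwo_of_lt (by omega), skipTwo_of_le le_rfl]
    have := hT (a + 3)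
    have e : a + 1 + 1 + 2 = a + 3 + 1 := by omega
    rw [e]
    omega
  · rw [skipTwo_of_lt (by omega), skipTwo_of_lt (by omega)]
    exact hT (k + 2)

/-! ### Measurability of properties of paths -/

/-- A property of a pair of paths which depends on finitely many of their values is measurable. -/
theorem measurableSet_of_forall_eq {Q : (ℤ → ℤ) → (ℕ → ℤ) → Prop} (N : ℕ)
    (hQ : ∀ r r' σ σ', (∀ k : ℤ, |k| ≤ N → r k = r' k) → (∀ k ≤ N, σ k = σ' k) →
      Q r σ → Q r' σ') :
    MeasurableSet {x : (ℤ → ℤ) × (ℕ → ℤ) | Q x.1 x.2} := by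
  let π : (ℤ → ℤ) × (ℕ → ℤ) →
      ((Finset.Icc (-(N : ℤ)) N : Finset ℤ) → ℤ) × ((Finset.range (N + 1) : Finset ℕ) → ℤ) :=
    fun x => (fun k => x.1 k, fun k => x.2 k)
  have hπ : Measurable π := by fun_prop
  -- The restriction to finitely many times has a countable target, where every set is measurable.
  have : {x : (ℤ → ℤ) × (ℕ → ℤ) | Q x.1 x.2} = π ⁻¹' (π '' {x | Q x.1 x.2}) := by
    refine Set.Subset.antisymm (Set.subset_preimage_image _ _) ?_
    rintro x ⟨y, hy, hxy⟩
    refine hQ _ _ _ _ (fun k hk => ?_) (fun k hk => ?_) hy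
    · exact congrFun (congrArg Prod.fst hxy) ⟨k, Finset.mem_Icc.2 (abs_le.1 hk)⟩
    · exact congrFun (congrArg Prod.snd hxy) ⟨k, Finset.mem_range.2 (by omega)⟩
  rw [this]
  exact hπ (Set.to_countable _).measurableSet

theorem measurableSet_of_forall_eq_nat {Q : (ℕ → ℤ) → Prop} (N : ℕ)
    (hQ : ∀ σ σ', (∀ k ≤ N, σ k = σ' k) → Q σ → Q σ') : MeasurableSet {σ : ℕ → ℤ | Q σ} := by
  have h := measurableSet_of_forall_eq (Q := fun _ σ => Q σ) N fun _ _ σ σ' _ h => hQ σ σ' h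
  exact (measurable_const (a := (0 : ℤ → ℤ))).prodMk measurable_id h

section Congr

variable {ι : Type*} [LinearOrder ι] {T T' : ι → ℤ} {x₁ x₂ : ℤ}

theorem IsCrossing.congr {t : ι × ι} (h : ∀ u ∈ Set.uIcc t.1 t.2, T u = T' u)
    (ht : IsCrossing T x₁ x₂ t) : IsCrossing T' x₁ x₂ t := by
  refine ⟨ht.1, ?_, ?_, fun s h1 h2 => ?_⟩
  · rw [← h _ Set.left_mem_uIcc, ht.2.1]
  · rw [← h _ Set.right_mem_uIcc, ht.2.2.1]
  · rw [← h s ⟨h1.le, h2.le⟩]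
    exact ht.2.2.2 s h1 h2

theorem isCrossing_congr {t : ι × ι} (h : ∀ u ∈ Set.uIcc t.1 t.2, T u = T' u) :
    IsCrossing T x₁ x₂ t ↔ IsCrossing T' x₁ x₂ t :=
  ⟨IsCrossing.congr h, IsCrossing.congr fun u hu => (h u hu).symm⟩

end Congr

theorem IsNthCrossing.congr {T T' : ℕ → ℤ} {x₁ x₂ : ℤ} {i : ℕ} {t : ℕ × ℕ}
    (h : ∀ u ≤ max t.1 t.2, T u = T' u) (ht : IsNthCrossing T x₁ x₂ i t) :
    IsNthCrossing T' x₁ x₂ i t := by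
  refine ⟨ht.1.congr fun u hu => h u hu.2, ?_⟩
  rw [← ht.2]
  congr 2
  ext s
  refine and_congr_left fun hs => (isCrossing_congr fun u hu => h u ?_).symm
  have : u ≤ max s.1 s.2 := hu.2
  omega

theorem IsFirstCrossingDuring.congr {T T' : ℕ → ℤ} {x₁ x₂ : ℤ} {t s : ℕ × ℕ}
    (h : ∀ u ∈ Set.uIcc t.1 t.2, T u = T' u) (hs : IsFirstCrossingDuring T x₁ x₂ t s) :
    IsFirstCrossingDuring T' x₁ x₂ t s := by
  have key : ∀ r : ℕ × ℕ, r.1 ∈ Set.uIcc t.1 t.2 → r.2 ∈ Set.uIcc t.1 t.2 →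
      (IsCrossing T x₁ x₂ r ↔ IsCrossing T' x₁ x₂ r) := fun r h1 h2 =>
    isCrossing_congr fun u hu => h u (Set.uIcc_subset_uIcc h1 h2 hu)
  obtain ⟨h1, h2, h3, h4⟩ := hs
  exact ⟨(key s h2 h3).1 h1, h2, h3, fun r hr h5 h6 => h4 r ((key r h5 h6).2 hr) h5 h6⟩

theorem measurableSet_isLocus (l : LocusLabel) (s : ℕ × ℕ) :
    MeasurableSet {T : ℕ → ℤ | IsLocus T l s} := by
  have : {T : ℕ → ℤ | IsLocus T l s} = ⋃ t : ℕ × ℕ,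
      {T | IsNthCrossing T l.k₁ l.k₂ l.i t ∧ IsFirstCrossingDuring T l.j₁ l.j₂ t s} := by
    ext T
    simp [IsLocus]
  rw [this]
  refine MeasurableSet.iUnion fun t => ?_
  refine measurableSet_of_forall_eq_nat (max t.1 t.2) fun σ σ' h ⟨h1, h2⟩ =>
    ⟨h1.congr h, h2.congr fun u hu => h u hu.2⟩

theorem measurableSet_isStraightLocus (l : LocusLabel) :
    MeasurableSet {T : ℕ → ℤ | IsStraightLocus T l} := by
  have : {T : ℕ → ℤ | IsStraightLocus T l} =
      ⋃ s : ℕ × ℕ, {T | IsLocus T l s} ∩ {_T | |(s.1 : ℤ) - s.2| = |l.j₁ - l.j₂|} := by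
    ext T
    simp [IsStraightLocus]
  rw [this]
  exact MeasurableSet.iUnion fun s => (measurableSet_isLocus l s).inter (MeasurableSet.const _)

theorem measurableSet_locusBegins (l : LocusLabel) (a : ℕ) (up : Bool) :
    MeasurableSet {T : ℕ → ℤ | LocusBegins T l a up} := by
  have : {T : ℕ → ℤ | LocusBegins T l a up} = (fun T : ℕ → ℤ => T a) ⁻¹' {l.start up} ∩
      ⋃ s : ℕ × ℕ, {T | IsLocus T l s} ∩ {_T | min s.1 s.2 = a} := by
    ext T
    simp [LocusBegins]
  rw [this]
  exact (measurable_pi_apply a (measurableSet_singleton _)).inter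
    (MeasurableSet.iUnion fun s => (measurableSet_isLocus l s).inter (MeasurableSet.const _))

/-! ### Simple random walks -/

/-- Subfamilies of an independent family with disjoint index sets are independent. -/
theorem ProbabilityTheory.iIndepFun.indepFun_subtype {Ω ι β : Type*} [MeasurableSpace Ω]
    [MeasurableSpace β] {P : Measure Ω} {X : ι → Ω → β} (hX : iIndepFun X P)
    (hm : ∀ i, Measurable (X i)) {A B : Set ι} (hAB : Disjoint A B) :
    IndepFun (fun ω (i : A) => X i ω) (fun ω (i : B) => X i ω) P := by
  rw [IndepFun_iff_Indep]
  have h := indep_iSup_of_disjoint (fun i => (hm i).comap_le) ((iIndepFun_iff_iIndep _ _ _).1 hX) hAB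
  have key : ∀ A : Set ι, MeasurableSpace.comap (fun ω (i : A) => X i ω) MeasurableSpace.pi ≤
      ⨆ i ∈ A, MeasurableSpace.comap (X i) inferInstance := by
    intro A
    rw [MeasurableSpace.pi, MeasurableSpace.comap_iSup]
    refine iSup_le fun i => ?_
    rw [MeasurableSpace.comap_comp]
    exact le_iSup₂ (f := fun i (_ : i ∈ A) => MeasurableSpace.comap (X i) inferInstance) i.1 i.2
  exact indep_of_indep_of_le_left (indep_of_indep_of_le_right h (key B)) (key A)

/-- The law of a fair step. -/
theorem measure_eq_of_fair {μ ν : Measure ℤ} [IsProbabilityMeasure μ] [IsProbabilityMeasure ν]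
    (hμ : μ {1} = 1 / 2) (hμ' : μ {-1} = 1 / 2) (hν : ν {1} = 1 / 2) (hν' : ν {-1} = 1 / 2) :
    μ = ν := by
  have key : ∀ {μ : Measure ℤ} [IsProbabilityMeasure μ], μ {1} = 1 / 2 → μ {-1} = 1 / 2 →
      ∀ x : ℤ, x ≠ 1 → x ≠ -1 → μ {x} = 0 := by
    intro μ _ h1 h2 x hx1 hx2
    have h3 : μ {1, -1} = 1 := by
      rw [Set.insert_eq, measure_union (by simp) (by simp), h1, h2, ENNReal.add_halves]
    have h4 : μ ({1, -1}ᶜ) = 0 := by rw [prob_compl_eq_zero_iff (by simp)]; exact h3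
    exact measure_mono_null (by simp [hx1, hx2]) h4
  refine Measure.ext_of_singleton fun x => ?_
  by_cases h1 : x = 1
  · rw [h1, hμ, hν]
  by_cases h2 : x = -1
  · rw [h2, hμ', hν']
  rw [key hμ hμ' x h1 h2, key hν hν' x h1 h2]

/-- The path with given steps. -/
def pathOfSteps (x : ℕ → ℤ) (k : ℕ) : ℤ := ∑ i ∈ Finset.range k, x i

theorem measurable_pathOfSteps : Measurable pathOfSteps := by
  unfold pathOfSteps
  fun_prop

namespace IsSimpleRandomWalk

variable {Ω : Type*} [MeasurableSpace Ω] {P : Measure Ω} {S : ℕ → Ω → ℤ}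

theorem measurable_step (hS : IsSimpleRandomWalk P S) (k : ℕ) :
    Measurable fun ω => S (k + 1) ω - S k ω := (hS.measurable (k + 1)).sub (hS.measurable k)

theorem measurable_path (hS : IsSimpleRandomWalk P S) : Measurable fun ω k => S k ω :=
  measurable_pi_iff.2 hS.measurable

theorem neg (hS : IsSimpleRandomWalk P S) : IsSimpleRandomWalk P fun k ω => -S k ω where
  measurable k := (hS.measurable k).neg
  start := by filter_upwards [hS.start] with ω h; simp [h]
  indep := by
    have := hS.indep.comp (fun _ x => -x) fun _ => measurable_neg
    convert this using 2 with k
    ext ω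
    simp only [Function.comp_apply]
    ring
  step_right k := by
    rw [← hS.step_left k]
    congr 1
    ext ω
    simp only [Set.mem_ofPred_eq]
    omega
  step_left k := by
    rw [← hS.step_right k]
    congr 1
    ext ω
    simp only [Set.mem_ofPred_eq]
    omega

variable [IsProbabilityMeasure P]

theorem ae_step (hS : IsSimpleRandomWalk P S) :
    ∀ᵐ ω ∂P, IsNearestNeighbor fun k => S k ω := by
  refine ae_all_iff.2 fun k => ?_
  have hm := hS.measurable_step k
  have h1 : MeasurableSet {ω | S (k + 1) ω - S k ω = 1} := hm (measurableSet_singleton 1)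
  have h2 : MeasurableSet {ω | S (k + 1) ω - S k ω = -1} := hm (measurableSet_singleton (-1))
  have h3 : P ({ω | S (k + 1) ω - S k ω = 1} ∪ {ω | S (k + 1) ω - S k ω = -1}) = 1 := by
    rw [measure_union _ h2, hS.step_right, hS.step_left, ENNReal.add_halves]
    refine Set.disjoint_left.2 fun ω e1 e2 => ?_
    simp only [Set.mem_ofPred_eq] at e1 e2
    omega
  rw [← mem_ae_iff_prob_eq_one (h1.union h2)] at h3
  filter_upwards [h3] with ω hω
  rcases hω with h | h <;> simp only [Set.mem_ofPred_eq] at h <;> omega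

theorem integral_step (hS : IsSimpleRandomWalk P S) (k : ℕ) :
    Integrable (fun ω => ((S (k + 1) ω - S k ω : ℤ) : ℝ)) P ∧
      ∫ ω, ((S (k + 1) ω - S k ω : ℤ) : ℝ) ∂P = 0 := by
  have hm := hS.measurable_step k
  have h1 : MeasurableSet {ω | S (k + 1) ω - S k ω = 1} := hm (measurableSet_singleton 1)
  have hae : (fun ω => ((S (k + 1) ω - S k ω : ℤ) : ℝ)) =ᵐ[P]
      fun ω => {ω | S (k + 1) ω - S k ω = 1}.indicator (fun _ => (2 : ℝ)) ω - 1 := by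
    filter_upwards [hS.ae_step] with ω hω
    by_cases h : S (k + 1) ω - S k ω = 1
    · rw [Set.indicator_of_mem (by exact h), h]
      norm_num
    · rw [Set.indicator_of_notMem (by exact h)]
      have h' : S (k + 1) ω = S k ω + 1 ∨ S (k + 1) ω = S k ω - 1 := hω k
      have : S (k + 1) ω - S k ω = -1 := by omega
      rw [this]
      norm_num
  have hi : Integrable ({ω | S (k + 1) ω - S k ω = 1}.indicator (fun _ => (2 : ℝ))) P :=
    (integrable_const _).indicator h1
  refine ⟨(integrable_congr hae).2 (hi.sub (integrable_const _)), ?_⟩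
  rw [integral_congr_ae hae, integral_sub hi (integrable_const _), integral_indicator_const _ h1,
    measureReal_def, hS.step_right]
  simp

/-- The walk is a martingale with bounded increments, so almost surely it is bounded above only
where it converges; steps of size one rule out convergence. -/
theorem ae_not_bddAbove (hS : IsSimpleRandomWalk P S) :
    ∀ᵐ ω ∂P, ∀ B : ℤ, ∃ k, B < S k ω := by
  let X : ℕ → Ω → ℤ := fun k ω => S (k + 1) ω - S k ω
  let ℱ : Filtration ℕ (inferInstance : MeasurableSpace Ω) :=
    { seq := fun k => ⨆ i ∈ Set.Iio k, MeasurableSpace.comap (X i) inferInstance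
      mono' := fun a b hab => biSup_mono fun i hi => lt_of_lt_of_le hi hab
      le' := fun k => iSup₂_le fun i _ => (hS.measurable_step i).comap_le }
  let W : ℕ → Ω → ℝ := fun k ω => ∑ i ∈ Finset.range k, ((X i ω : ℤ) : ℝ)
  have hstep : ∀ k, W (k + 1) - W k = fun ω => ((X k ω : ℤ) : ℝ) := fun k => by
    ext ω
    simp [W, Finset.sum_range_succ]
  have hW : Martingale W ℱ P := by
    refine martingale_of_condExp_sub_eq_zero_nat (fun k => ?_) (fun k => ?_) fun k => ?_
    · refine Measurable.stronglyMeasurable ?_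
      refine Finset.measurable_fun_sum _ fun i hi => ?_
      refine (measurable_from_top (f := fun n : ℤ => (n : ℝ))).comp ?_
      refine (comap_measurable (X i)).mono ?_ le_rfl
      exact le_iSup₂ (f := fun i (_ : i ∈ Set.Iio k) => MeasurableSpace.comap (X i) inferInstance)
        i (Finset.mem_range.1 hi)
    · exact integrable_finsetSum _ fun i _ => (hS.integral_step i).1
    · rw [hstep]
      have hind := indep_iSup_of_disjoint (fun i => (hS.measurable_step i).comap_le)
        ((iIndepFun_iff_iIndep _ _ _).1 hS.indep) (S := {k}) (T := Set.Iio k) (by simp)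
      have h := condExp_indep_eq (μ := P) (f := fun ω => ((X k ω : ℤ) : ℝ))
        (iSup₂_le fun i _ => (hS.measurable_step i).comap_le) (ℱ.le k) ?_ hind
      · rw [(hS.integral_step k).2] at h
        exact h
      · refine Measurable.stronglyMeasurable ?_
        refine (measurable_from_top (f := fun n : ℤ => (n : ℝ))).comp ?_
        refine (comap_measurable (X k)).mono ?_ le_rfl
        exact le_iSup₂ (f := fun i (_ : i ∈ ({k} : Set ℕ)) =>
          MeasurableSpace.comap (X i) inferInstance) k rfl
  have hdiff : ∀ᵐ ω ∂P, ∀ k, |W (k + 1) ω - W k ω| = 1 := by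
    filter_upwards [hS.ae_step] with ω hω k
    have h1 : W (k + 1) ω - W k ω = ((X k ω : ℤ) : ℝ) := congrFun (hstep k) ω
    have h2 : X k ω = 1 ∨ X k ω = -1 := by
      have h' : S (k + 1) ω = S k ω + 1 ∨ S (k + 1) ω = S k ω - 1 := hω k
      simp only [X]
      omega
    rw [h1]
    rcases h2 with h | h <;> rw [h] <;> simp
  have hb := hW.submartingale.bddAbove_iff_exists_tendsto (R := 1)
    (hdiff.mono fun ω h k => by simp [h k])
  filter_upwards [hb, hdiff, hS.start] with ω h1 h2 h3 B
  have hWS : ∀ k, W k ω = S k ω := fun k => by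
    simp only [W, X]
    rw [← Int.cast_sum, Finset.sum_range_sub (fun k => S k ω), h3, sub_zero]
  by_contra! hB
  obtain ⟨c, hc⟩ := h1.1 ⟨(B : ℝ), by
    rintro _ ⟨k, rfl⟩
    change W k ω ≤ B
    rw [hWS]
    exact_mod_cast hB k⟩
  have h4 := ((hc.comp (Filter.tendsto_add_atTop_nat 1)).sub hc).abs
  simp only [Function.comp_def, h2, sub_self, abs_zero] at h4
  exact one_ne_zero (tendsto_nhds_unique tendsto_const_nhds h4)

theorem ae_isRecurrent (hS : IsSimpleRandomWalk P S) : ∀ᵐ ω ∂P, IsRecurrent fun k => S k ω := by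
  filter_upwards [hS.ae_step, hS.ae_not_bddAbove, hS.neg.ae_not_bddAbove] with ω hn h1 h2 x N
  -- A nearest-neighbor path needs more than `N` steps to get beyond this level, so both `b` and `c`
  -- are later than `N`, and `x` is visited between them.
  obtain ⟨b, hb⟩ := h1 (|x| + |S 0 ω| + N)
  obtain ⟨c, hc⟩ := h2 (|x| + |S 0 ω| + N)
  have hb' := hn.abs_sub_le b 0
  have hc' := hn.abs_sub_le c 0
  have hx : x ∈ Set.uIcc (S b ω) (S c ω) := by
    rw [Set.mem_uIcc]
    simp only [abs_eq_max_neg] at *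
    omega
  obtain ⟨k, hk, hk'⟩ := hn.exists_eq (a := b) (b := c) hx
  refine ⟨k, ?_, hk'⟩
  rw [Set.mem_uIcc] at hk
  simp only [abs_eq_max_neg] at *
  push_cast at *
  omega

end IsSimpleRandomWalk

/-! ### Deleting a backtrack from a simple random walk, and the probability of straight loci. -/

/-- The increasing enumeration of all steps except those at the times `a + 1` and `a + 2`. -/
def skipStep (a i : ℕ) : ℕ := if i ≤ a then i else i + 2

theorem skipStep_injective (a : ℕ) : Function.Injective (skipStep a) := fun i j h => by
  unfold skipStep at h
  split_ifs at h <;> omega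

theorem skipStep_mem (a i : ℕ) : skipStep a i ∈ ({a + 1, a + 2}ᶜ : Set ℕ) := by
  simp only [Set.mem_compl_iff, Set.mem_insert_iff, Set.mem_singleton_iff]
  unfold skipStep
  split_ifs <;> omega

/-- The two deleted steps cancel, so the shortened path is built from the remaining steps alone.
This is what makes it independent of the backtrack. -/
theorem StepsBack.comp_skipTwo {T : ℕ → ℤ} (h0 : T 0 = 0) {a : ℕ} {up : Bool}
    (h : StepsBack T a up) :
    T ∘ skipTwo a = pathOfSteps fun i => T (skipStep a i + 1) - T (skipStep a i) := by
  obtain ⟨h1, h2⟩ := h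
  funext k
  induction k with
  | zero => simp [pathOfSteps, skipTwo, h0]
  | succ k ih =>
    unfold pathOfSteps at ih ⊢
    rw [Finset.sum_range_succ, ← ih, Function.comp_apply, Function.comp_apply]
    rcases lt_trichotomy k (a + 1) with hk | rfl | hk
    · rw [skipTwo_of_le (by omega), skipTwo_of_le (by omega), skipStep, if_pos (by omega)]
      ring
    · rw [skipTwo_of_lt (by omega), skipTwo_of_le le_rfl, skipStep, if_neg (by omega)]
      have e : a + 1 + 1 + 2 = a + 1 + 2 + 1 := by omega
      have e' : a + 1 + 2 = a + 3 := by omega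
      rw [e, e']
      linarith
    · rw [skipTwo_of_lt (by omega), skipTwo_of_lt (by omega), skipStep, if_neg (by omega)]
      have e : k + 1 + 2 = k + 2 + 1 := by omega
      rw [e]
      ring

namespace IsSimpleRandomWalk

variable {Ω : Type*} [MeasurableSpace Ω] {P : Measure Ω} {S : ℕ → Ω → ℤ}

theorem measure_step (hS : IsSimpleRandomWalk P S) (k : ℕ) (up : Bool) :
    P {ω | S (k + 1) ω - S k ω = signStep up} = 1 / 2 := by
  cases up
  · exact hS.step_left k
  · exact hS.step_right k

variable [IsProbabilityMeasure P]

theorem map_step (hS : IsSimpleRandomWalk P S) (j k : ℕ) :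
    P.map (fun ω => S (j + 1) ω - S j ω) = P.map fun ω => S (k + 1) ω - S k ω := by
  have := Measure.isProbabilityMeasure_map (hS.measurable_step j).aemeasurable (μ := P)
  have := Measure.isProbabilityMeasure_map (hS.measurable_step k).aemeasurable (μ := P)
  have key : ∀ (i : ℕ) (x : ℤ), P.map (fun ω => S (i + 1) ω - S i ω) {x} =
      P {ω | S (i + 1) ω - S i ω = x} := fun i x =>
    Measure.map_apply (hS.measurable_step i) (measurableSet_singleton x)
  refine measure_eq_of_fair ?_ ?_ ?_ ?_ <;> rw [key]
  exacts [hS.step_right j, hS.step_left j, hS.step_right k, hS.step_left k]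

/-- The walk with the steps at the times `a + 1` and `a + 2` deleted is again a simple random walk. -/
theorem map_pathOfSteps_skipStep (hS : IsSimpleRandomWalk P S) (a : ℕ) {F : Set (ℕ → ℤ)}
    (hF : MeasurableSet F) :
    P {ω | pathOfSteps (fun i => S (skipStep a i + 1) ω - S (skipStep a i) ω) ∈ F} =
      P {ω | (fun k => S k ω) ∈ F} := by
  have h1 := hS.indep.map_fun_eq_infinitePi_map hS.measurable_step
  have h2 := (hS.indep.precomp (skipStep_injective a)).map_fun_eq_infinitePi_map
    fun i => hS.measurable_step (skipStep a i)
  have h3 : P.map (fun ω i => S (skipStep a i + 1) ω - S (skipStep a i) ω) =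
      P.map (fun ω i => S (i + 1) ω - S i ω) := by
    rw [h1]
    refine h2.trans ?_
    congr 1
    funext i
    exact hS.map_step (skipStep a i) i
  have hm1 : Measurable fun ω i => S (skipStep a i + 1) ω - S (skipStep a i) ω :=
    measurable_pi_iff.2 fun i => hS.measurable_step (skipStep a i)
  have hm2 : Measurable fun ω i => S (i + 1) ω - S i ω := measurable_pi_iff.2 hS.measurable_step
  have hF' := measurable_pathOfSteps hF
  have h4 := congrArg (fun μ => μ (pathOfSteps ⁻¹' F)) h3
  simp only [Measure.map_apply hm1 hF', Measure.map_apply hm2 hF'] at h4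
  refine h4.trans (measure_congr ?_)
  filter_upwards [hS.start] with ω hω
  have : pathOfSteps (fun i => S (i + 1) ω - S i ω) = fun k => S k ω := by
    funext k
    rw [pathOfSteps, Finset.sum_range_sub (fun k => S k ω), hω, sub_zero]
  change (pathOfSteps (fun i => S (i + 1) ω - S i ω) ∈ F) = _
  rw [this]
  rfl

/-- The backtrack depends on the steps `a + 1` and `a + 2`, the shortened path on all the others.
These are independent, and the others again form a simple random walk. -/
theorem measure_stepsBack (hS : IsSimpleRandomWalk P S) (a : ℕ) (up : Bool) {F : Set (ℕ → ℤ)}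
    (hF : MeasurableSet F) :
    P {ω | StepsBack (fun k => S k ω) a up ∧ (fun k => S k ω) ∘ skipTwo a ∈ F} =
      1 / 4 * P {ω | (fun k => S k ω) ∈ F} := by
  have hind := hS.indep.indepFun_subtype hS.measurable_step
    (disjoint_compl_right (a := ({a + 1, a + 2} : Set ℕ)))
  let A : Set (({a + 1, a + 2} : Set ℕ) → ℤ) :=
    {x | x ⟨a + 1, by simp⟩ = signStep up ∧ x ⟨a + 2, by simp⟩ = -signStep up}
  let B : Set ((({a + 1, a + 2}ᶜ : Set ℕ)) → ℤ) :=
    {x | pathOfSteps (fun i => x ⟨skipStep a i, skipStep_mem a i⟩) ∈ F}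
  have hA : MeasurableSet A :=
    ((measurable_pi_apply _ (measurableSet_singleton _)).inter
      (measurable_pi_apply _ (measurableSet_singleton _)))
  have hB : MeasurableSet B := by
    have : Measurable fun x : (({a + 1, a + 2}ᶜ : Set ℕ)) → ℤ =>
        pathOfSteps (fun i => x ⟨skipStep a i, skipStep_mem a i⟩) :=
      measurable_pathOfSteps.comp (by fun_prop)
    exact this hF
  have h := hind.measure_inter_preimage_eq_mul A B hA hB
  have hAB : P {ω | StepsBack (fun k => S k ω) a up ∧ (fun k => S k ω) ∘ skipTwo a ∈ F} =
      P ((fun ω (i : ({a + 1, a + 2} : Set ℕ)) => S (i + 1) ω - S i ω) ⁻¹' A ∩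
        (fun ω (i : ({a + 1, a + 2}ᶜ : Set ℕ)) => S (i + 1) ω - S i ω) ⁻¹' B) := by
    refine measure_congr ?_
    filter_upwards [hS.start] with ω hω
    refine propext ?_
    refine and_congr_right fun hs => ?_
    rw [StepsBack.comp_skipTwo (T := fun k => S k ω) hω hs]
    rfl
  rw [hAB, h]
  congr 1
  · have h2 := (hS.indep.indepFun (i := a + 1) (j := a + 2) (by omega)).measure_inter_preimage_eq_mul
      {signStep up} {signStep !up} (measurableSet_singleton _) (measurableSet_singleton _)
    have e : ∀ up, -signStep up = signStep !up := by intro up; cases up <;> rfl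
    have e1 := hS.measure_step (a + 1) up
    have e2 := hS.measure_step (a + 2) !up
    have : ((fun ω (i : ({a + 1, a + 2} : Set ℕ)) => S (i + 1) ω - S i ω) ⁻¹' A) =
        (fun ω => S (a + 1 + 1) ω - S (a + 1) ω) ⁻¹' {signStep up} ∩
          (fun ω => S (a + 2 + 1) ω - S (a + 2) ω) ⁻¹' {signStep !up} := by
      ext ω
      simp [A, e]
    rw [this, h2]
    change P {ω | S (a + 1 + 1) ω - S (a + 1) ω = signStep up} *
      P {ω | S (a + 2 + 1) ω - S (a + 2) ω = signStep !up} = _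
    rw [e1, e2, one_div, ← ENNReal.mul_inv (by simp) (by simp), one_div]
    norm_num
  · exact hS.map_pathOfSteps_skipStep a hF

/-- Loci are added one at a time. On the event `F` that the previous ones are straight, the new one
fails with conditional probability 1/4, by deletion of the backtrack at its beginning. -/
theorem measure_forall_isStraightLocus (hS : IsSimpleRandomWalk P S) {β : Type*} [DecidableEq β]
    (l : β → LocusLabel) (s : Finset β) (hi : ∀ b ∈ s, 0 < (l b).i)
    (hk : ∀ b ∈ s, (l b).k₁ ≠ (l b).k₂) (hj : ∀ b ∈ s, |(l b).j₁ - (l b).j₂| = 3)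
    (hj₁ : ∀ b ∈ s, (l b).j₁ ∈ Set.uIcc (l b).k₁ (l b).k₂)
    (hj₂ : ∀ b ∈ s, (l b).j₂ ∈ Set.uIcc (l b).k₁ (l b).k₂)
    (havoid : ∀ b ∈ s, ∀ c ∈ s, (l b).AvoidsAll (l c))
    (hsep : ∀ b ∈ s, ∀ c ∈ s, b ≠ c → (l b).Separated (l c)) :
    P {ω | ∀ b ∈ s, IsStraightLocus (fun k => S k ω) (l b)} = (3 / 4) ^ s.card := by
  induction s using Finset.induction_on with
  | empty => simp
  | insert b s hb ih =>
    simp only [Finset.mem_insert, forall_eq_or_imp] at hi hk hj hj₁ hj₂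
    have ih' := ih hi.2 hk.2 hj.2 hj₁.2 hj₂.2
      (fun b hb c hc => havoid b (Finset.mem_insert_of_mem hb) c (Finset.mem_insert_of_mem hc))
      (fun b hb c hc => hsep b (Finset.mem_insert_of_mem hb) c (Finset.mem_insert_of_mem hc))
    have hself := havoid b (Finset.mem_insert_self b s) b (Finset.mem_insert_self b s)
    have havoid' : ∀ c ∈ s, (l b).AvoidsAll (l c) := fun c hc =>
      havoid b (Finset.mem_insert_self b s) c (Finset.mem_insert_of_mem hc)
    have hsep' : ∀ c ∈ s, (l b).Separated (l c) := fun c hc =>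
      hsep b (Finset.mem_insert_self b s) c (Finset.mem_insert_of_mem hc) fun e => hb (e ▸ hc)
    have hjne : (l b).j₁ ≠ (l b).j₂ := fun e => by
      have := hj.1
      rw [e] at this
      simp at this
    let F : Set (ℕ → ℤ) := {T | ∀ c ∈ s, IsStraightLocus T (l c)}
    let G : Set (ℕ → ℤ) := {T | IsStraightLocus T (l b)}
    let B : ℕ × Bool → Set (ℕ → ℤ) := fun c => {T | LocusBegins T (l b) c.1 c.2}
    have hF : MeasurableSet F := by
      have : F = ⋂ c ∈ s, {T | IsStraightLocus T (l c)} := by ext; simp [F]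
      rw [this]
      exact Finset.measurableSet_biInter _ fun c _ => measurableSet_isStraightLocus (l c)
    have hG : MeasurableSet G := measurableSet_isStraightLocus (l b)
    have hB : ∀ c, MeasurableSet (B c) := fun c => measurableSet_locusBegins (l b) c.1 c.2
    let μ := P.map fun ω k => S k ω
    have hμ : ∀ A, MeasurableSet A → μ A = P {ω | (fun k => S k ω) ∈ A} := fun A hA =>
      Measure.map_apply hS.measurable_path hA
    have : IsProbabilityMeasure μ :=
      Measure.isProbabilityMeasure_map hS.measurable_path.aemeasurable
    have hex : ∀ᵐ ω ∂P, ∃ c, (fun k => S k ω) ∈ B c := by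
      filter_upwards [hS.ae_step, hS.ae_isRecurrent] with ω h1 h2
      obtain ⟨s, hs⟩ := exists_isLocus h1 h2 hi.1 hjne hk.1 hj₁.1 hj₂.1
      obtain ⟨a, up, h⟩ := hs.exists_locusBegins
      exact ⟨(a, up), h⟩
    have hsum : ∀ A, MeasurableSet A → μ A = ∑' c, μ (A ∩ B c) := by
      intro A hA
      rw [← measure_iUnion (fun c d hcd => ?_) fun c => hA.inter (hB c), ← Set.inter_iUnion,
        hμ _ hA, hμ _ (hA.inter (MeasurableSet.iUnion hB))]
      · refine measure_congr ?_
        filter_upwards [hex] with ω hω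
        refine propext (and_iff_left ?_).symm
        exact Set.mem_iUnion.2 hω
      · refine Set.disjoint_left.2 fun T h1 h2 => hcd ?_
        obtain ⟨h3, h4⟩ := LocusBegins.unique hjne h1.2 h2.2
        exact Prod.ext h3 h4
    -- For each starting time and direction, the paths in `F \ G` are exactly those which step back
    -- there and whose shortened path is in `F` with the locus of `l b` beginning at the same place.
    have hquarter : μ (F \ G) = 1 / 4 * μ F := by
      rw [hsum _ (hF.diff hG), hsum _ hF, ← ENNReal.tsum_mul_left]
      congr 1
      funext c
      rw [hμ _ (hF.inter (hB c)), ← hS.measure_stepsBack c.1 c.2 (hF.inter (hB c)),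
        hμ _ ((hF.diff hG).inter (hB c))]
      refine measure_congr ?_
      filter_upwards [hS.ae_step] with ω hω
      have key := hω.locusBegins_and_not_isStraightLocus_iff hj.1 hself (a := c.1) (up := c.2)
        fun h => h.isNearestNeighbor hω
      have key2 := fun h : StepsBack (fun k => S k ω) c.1 c.2 ∧
          LocusBegins ((fun k => S k ω) ∘ skipTwo c.1) (l b) c.1 c.2 =>
        fun d (hd : d ∈ s) => StepsBack.isStraightLocus_iff hj.1 (havoid' d hd) (hsep' d hd)
          (h.1.isNearestNeighbor hω) h.1 h.2
      refine propext ⟨?_, ?_⟩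
      · rintro ⟨⟨h1, h2⟩, h3⟩
        have h4 := key.1 ⟨h3, h2⟩
        exact ⟨h4.1, fun d hd => (key2 h4 d hd).1 (h1 d hd), h4.2⟩
      · rintro ⟨h1, h2, h3⟩
        have h4 := key.2 ⟨h1, h3⟩
        exact ⟨⟨fun d hd => (key2 ⟨h1, h3⟩ d hd).2 (h2 d hd), h4.2⟩, h4.1⟩
    have hF' : μ F = (3 / 4) ^ s.card := by rw [hμ F hF]; exact ih'
    have hset : {ω | ∀ c ∈ insert b s, IsStraightLocus (fun k => S k ω) (l c)} =
        {ω | (fun k => S k ω) ∈ F ∩ G} := by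
      ext ω
      simp only [Finset.mem_insert, forall_eq_or_imp, Set.mem_ofPred_eq, Set.mem_inter_iff, F, G]
      exact and_comm
    rw [hset, ← hμ _ (hF.inter hG), Finset.card_insert_of_notMem hb, pow_succ, ← hF', mul_comm]
    have hadd := measure_inter_add_sdiff (μ := μ) F hG
    rw [hquarter] at hadd
    have h34 : (3 / 4 : ENNReal) * μ F + 1 / 4 * μ F = μ F := by
      rw [← add_mul, ENNReal.div_add_div_same]
      norm_num
      rw [ENNReal.div_self (by simp) (by simp), one_mul]
    refine (ENNReal.add_left_inj (a := 1 / 4 * μ F) ?_).1 (hadd.trans h34.symm)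
    exact ENNReal.mul_ne_top (by simp) (measure_ne_top _ _)

end IsSimpleRandomWalk

/-! ### The representation of a fair scenery is a two-sided simple random walk -/

theorem periodicScenery_add_one_eq_iff (c : Fin 2) (x : ℤ) :
    periodicScenery c (x + 1) = periodicScenery c x ↔ x % 2 = 0 := by
  have h : ∀ c : Fin 2, 1 - c ≠ c := by decide
  have h' : ∀ c : Fin 2, c ≠ 1 - c := by decide
  unfold periodicScenery
  have h4 : x % 4 = 0 ∨ x % 4 = 1 ∨ x % 4 = 2 ∨ x % 4 = 3 := by omega
  rcases h4 with h0 | h0 | h0 | h0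
  · rw [if_pos (by omega), if_pos (by omega)]
    exact iff_of_true rfl (by omega)
  · rw [if_neg (by omega), if_pos (by omega)]
    exact iff_of_false (h c) (by omega)
  · rw [if_neg (by omega), if_neg (by omega)]
    exact iff_of_true rfl (by omega)
  · rw [if_pos (by omega), if_neg (by omega)]
    exact iff_of_false (h' c) (by omega)

theorem sceneryWalk_spec (ξ : ℤ → Fin 2) :
    (∀ k, sceneryWalk ξ (k + 1) = sceneryWalk ξ k + 1 ∨
      sceneryWalk ξ (k + 1) = sceneryWalk ξ k - 1) ∧ sceneryWalk ξ 0 = 0 ∧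
      ∀ k, periodicScenery (ξ 0) (sceneryWalk ξ k) = ξ k := by
  obtain ⟨h1, h2, h3⟩ := (eq_sceneryWalk_iff ξ _).2 rfl
  refine ⟨fun k => ?_, h2, h3⟩
  rcases (abs_eq one_pos.le).1 (h1 k) with h | h <;> omega

theorem sceneryWalk_emod_two (ξ : ℤ → Fin 2) (k : ℤ) : sceneryWalk ξ k % 2 = k % 2 := by
  obtain ⟨h1, h2, -⟩ := sceneryWalk_spec ξ
  induction k using Int.induction_on with
  | zero => rw [h2]
  | succ k ih =>
    have := h1 k
    omega
  | pred k ih =>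
    have := h1 (-(k : ℤ) - 1)
    rw [sub_add_cancel] at this
    omega

/-- Since R(k) has the parity of k, and the periodic scenery is constant between x and x + 1 exactly
for even x, each step of R is a function of two adjacent colours only. -/
theorem sceneryWalk_step_iff (ξ : ℤ → Fin 2) (k : ℤ) :
    sceneryWalk ξ (k + 1) - sceneryWalk ξ k = 1 ↔ (ξ (k + 1) = ξ k ↔ k % 2 = 0) := by
  obtain ⟨h1, -, h3⟩ := sceneryWalk_spec ξ
  have hpar := sceneryWalk_emod_two ξ k
  rw [← h3 (k + 1), ← h3 k]
  rcases h1 k with h | h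
  · rw [h, periodicScenery_add_one_eq_iff, hpar]
    simp
  · have e := periodicScenery_add_one_eq_iff (ξ 0) (sceneryWalk ξ k - 1)
    rw [sub_add_cancel] at e
    rw [h, eq_comm (a := periodicScenery (ξ 0) (sceneryWalk ξ k - 1)), e]
    constructor <;> intro h' <;> exfalso <;> omega

theorem sceneryWalk_nat_eq (ξ : ℤ → Fin 2) : (fun k : ℕ => sceneryWalk ξ k) =
    pathOfSteps fun i => sceneryWalk ξ ((i : ℤ) + 1) - sceneryWalk ξ i := by
  funext k
  have := Finset.sum_range_sub (fun k : ℕ => sceneryWalk ξ k) k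
  push_cast at this
  rw [pathOfSteps, this, (sceneryWalk_spec ξ).2.1, sub_zero]

theorem sceneryWalk_neg_eq (ξ : ℤ → Fin 2) : (fun k : ℕ => sceneryWalk ξ (-k)) =
    pathOfSteps fun i =>
      -(sceneryWalk ξ (-((i : ℤ) + 1) + 1) - sceneryWalk ξ (-((i : ℤ) + 1))) := by
  funext k
  have := Finset.sum_range_sub (fun k : ℕ => sceneryWalk ξ (-k)) k
  push_cast at this
  simp only [neg_zero, (sceneryWalk_spec ξ).2.1, sub_zero] at this
  rw [← this, pathOfSteps]
  refine Finset.sum_congr rfl fun i _ => ?_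
  have e : -((i : ℤ) + 1) + 1 = -i := by ring
  rw [e]
  ring

theorem measurableSet_sceneryWalk_step (k : ℤ) :
    MeasurableSet {ξ : ℤ → Fin 2 | sceneryWalk ξ (k + 1) - sceneryWalk ξ k = 1} := by
  simp only [sceneryWalk_step_iff]
  have : {ξ : ℤ → Fin 2 | ξ (k + 1) = ξ k ↔ k % 2 = 0} =
      (fun ξ => (ξ (k + 1), ξ k)) ⁻¹' {x | x.1 = x.2 ↔ k % 2 = 0} := rfl
  rw [this]
  exact ((measurable_pi_apply (k + 1)).prodMk (measurable_pi_apply k)) MeasurableSet.of_discrete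

theorem sceneryWalk_step_eq_indicator (ξ : ℤ → Fin 2) (k : ℤ) :
    sceneryWalk ξ (k + 1) - sceneryWalk ξ k =
      2 * {ξ | sceneryWalk ξ (k + 1) - sceneryWalk ξ k = 1}.indicator (fun _ => (1 : ℤ)) ξ - 1 := by
  have := (sceneryWalk_spec ξ).1 k
  by_cases h : sceneryWalk ξ (k + 1) - sceneryWalk ξ k = 1
  · rw [Set.indicator_of_mem (by exact h), h]
    norm_num
  · rw [Set.indicator_of_notMem (by exact h)]
    omega

theorem measurable_sceneryWalk_step (k : ℤ) :
    Measurable fun ξ => sceneryWalk ξ (k + 1) - sceneryWalk ξ k := by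
  rw [funext fun ξ => sceneryWalk_step_eq_indicator ξ k]
  exact ((measurable_const.indicator (measurableSet_sceneryWalk_step k)).const_mul 2).sub
    measurable_const

theorem measurable_sceneryWalk : Measurable sceneryWalk := by
  refine measurable_pi_iff.2 fun k => ?_
  obtain ⟨k, rfl | rfl⟩ := k.eq_nat_or_neg
  · have : (fun ξ => sceneryWalk ξ k) = fun ξ =>
        pathOfSteps (fun i => sceneryWalk ξ ((i : ℤ) + 1) - sceneryWalk ξ i) k :=
      funext fun ξ => congrFun (sceneryWalk_nat_eq ξ) k
    rw [this]
    exact Finset.measurable_fun_sum _ fun i _ => measurable_sceneryWalk_step i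
  · have : (fun ξ => sceneryWalk ξ (-k)) = fun ξ => pathOfSteps (fun i =>
        -(sceneryWalk ξ (-((i : ℤ) + 1) + 1) - sceneryWalk ξ (-((i : ℤ) + 1)))) k :=
      funext fun ξ => congrFun (sceneryWalk_neg_eq ξ) k
    rw [this]
    exact Finset.measurable_fun_sum _ fun i _ => (measurable_sceneryWalk_step _).neg

namespace IsFairScenery

variable {Ω : Type*} [MeasurableSpace Ω] {P : Measure Ω} {ξ : ℤ → Ω → Fin 2}

theorem measurable_scenery (hξ : IsFairScenery P ξ) : Measurable fun ω k => ξ k ω :=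
  measurable_pi_iff.2 hξ.measurable

theorem measurableSet_step (hξ : IsFairScenery P ξ) (k : ℤ) :
    MeasurableSet {ω | sceneryWalk (fun k => ξ k ω) (k + 1) -
      sceneryWalk (fun k => ξ k ω) k = 1} :=
  hξ.measurable_scenery (measurableSet_sceneryWalk_step k)

theorem measurable_step (hξ : IsFairScenery P ξ) (k : ℤ) :
    Measurable fun ω => sceneryWalk (fun k => ξ k ω) (k + 1) - sceneryWalk (fun k => ξ k ω) k :=
  (measurable_sceneryWalk_step k).comp hξ.measurable_scenery

theorem measurable_sceneryWalk (hξ : IsFairScenery P ξ) :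
    Measurable fun ω => sceneryWalk fun k => ξ k ω :=
  _root_.measurable_sceneryWalk.comp hξ.measurable_scenery

variable [IsProbabilityMeasure P]

/-- For the largest index k, the steps before k involve colours up to ξ(k) only. Given ξ(k) = c, the
step at k is upwards when the fresh colour ξ(k+1) has one prescribed value `d c`, which contributes
a factor 1/2. -/
theorem measure_biInter_step (hξ : IsFairScenery P ξ) (s : Finset ℤ) :
    P (⋂ k ∈ s, {ω | sceneryWalk (fun k => ξ k ω) (k + 1) -
      sceneryWalk (fun k => ξ k ω) k = 1}) = (1 / 2) ^ s.card := by
  classical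
  induction s using Finset.induction_on_max with
  | empty => simp
  | insert k s hs ih =>
    have hk : k ∉ s := fun h => lt_irrefl _ (hs k h)
    rw [Finset.card_insert_of_notMem hk, pow_succ, ← ih, Finset.set_biInter_insert]
    simp only [sceneryWalk_step_iff]
    set A : Set Ω := ⋂ x ∈ s, {ω | ξ (x + 1) ω = ξ x ω ↔ x % 2 = 0} with hA
    have hAm : MeasurableSet A := Finset.measurableSet_biInter _ fun j _ => by
      have := hξ.measurableSet_step j
      simp only [sceneryWalk_step_iff] at this
      exact this
    let D : Finset ℤ := insert k (s ∪ s.image (· + 1))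
    have hdisj : Disjoint D {k + 1} := by
      simp only [D, Finset.disjoint_singleton_right, Finset.mem_insert, Finset.mem_union,
        Finset.mem_image]
      rintro (h | h | ⟨x, hx, h⟩)
      · omega
      · have := hs _ h
        omega
      · have := hs _ hx
        omega
    have hind := hξ.indep.indepFun_finset D {k + 1} hdisj hξ.measurable
    let d : Fin 2 → Fin 2 := fun c => if k % 2 = 0 then c else 1 - c
    have hd : ∀ x c : Fin 2, (x = c ↔ k % 2 = 0) ↔ x = d c := by
      intro x c
      by_cases h : k % 2 = 0
      · simp [d, h]
      · simp only [d, h, if_false, iff_false]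
        revert x c
        decide
    have hc : ∀ c, P ((A ∩ {ω | ξ k ω = c}) ∩ {ω | ξ (k + 1) ω = d c}) =
        P (A ∩ {ω | ξ k ω = c}) * (1 / 2) := by
      intro c
      rw [← hξ.fair (k + 1) (d c)]
      have h := hind.measure_inter_preimage_eq_mul
        {x | (∀ j (hj : j ∈ s), (x ⟨j + 1, by simp [D, hj]⟩ = x ⟨j, by simp [D, hj]⟩ ↔ j % 2 = 0)) ∧
          x ⟨k, by simp [D]⟩ = c} {x | x ⟨k + 1, by simp⟩ = d c}
        MeasurableSet.of_discrete MeasurableSet.of_discrete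
      have e1 : A ∩ {ω | ξ k ω = c} = (fun ω (i : D) => ξ i ω) ⁻¹'
          {x | (∀ j (hj : j ∈ s), (x ⟨j + 1, by simp [D, hj]⟩ = x ⟨j, by simp [D, hj]⟩ ↔
            j % 2 = 0)) ∧ x ⟨k, by simp [D]⟩ = c} := by
        ext ω
        simp [hA]
      rw [e1]
      exact h
    have hsplit : ∀ B : Set Ω, MeasurableSet B → P B = ∑ c, P (B ∩ {ω | ξ k ω = c}) := by
      intro B hB
      have hm : ∀ c, MeasurableSet (B ∩ {ω | ξ k ω = c}) := fun c =>
        hB.inter (hξ.measurable k (measurableSet_singleton c))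
      rw [← measure_biUnion_finset (fun c _ c' _ hcc' => ?_) fun c _ => hm c]
      · congr 1
        ext ω
        simp
      · refine Set.disjoint_left.2 fun ω h1 h2 => hcc' ?_
        exact h1.2.symm.trans h2.2
    have hUm := hξ.measurableSet_step k
    simp only [sceneryWalk_step_iff] at hUm
    rw [hsplit _ (hUm.inter hAm), hsplit A hAm, Finset.sum_mul]
    refine Finset.sum_congr rfl fun c _ => ?_
    rw [← hc c]
    congr 1
    ext ω
    simp only [Set.mem_inter_iff, Set.mem_ofPred_eq, hd]
    constructor
    · rintro ⟨⟨h1, h2⟩, h3⟩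
      exact ⟨⟨h2, h3⟩, h3 ▸ h1⟩
    · rintro ⟨⟨h2, h3⟩, h1⟩
      exact ⟨⟨h3 ▸ h1, h2⟩, h3⟩

theorem measure_step (hξ : IsFairScenery P ξ) (k : ℤ) :
    P {ω | sceneryWalk (fun k => ξ k ω) (k + 1) - sceneryWalk (fun k => ξ k ω) k = 1} = 1 / 2 ∧
    P {ω | sceneryWalk (fun k => ξ k ω) (k + 1) - sceneryWalk (fun k => ξ k ω) k = -1} =
      1 / 2 := by
  have h1 : P {ω | sceneryWalk (fun k => ξ k ω) (k + 1) - sceneryWalk (fun k => ξ k ω) k = 1} =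
      1 / 2 := by simpa using hξ.measure_biInter_step {k}
  refine ⟨h1, ?_⟩
  have : {ω | sceneryWalk (fun k => ξ k ω) (k + 1) - sceneryWalk (fun k => ξ k ω) k = -1} =
      {ω | sceneryWalk (fun k => ξ k ω) (k + 1) - sceneryWalk (fun k => ξ k ω) k = 1}ᶜ := by
    ext ω
    have := (sceneryWalk_spec fun k => ξ k ω).1 k
    simp only [Set.mem_compl_iff, Set.mem_ofPred_eq]
    omega
  rw [this, prob_compl_eq_one_sub (hξ.measurableSet_step k), h1]
  simp

theorem iIndepFun_step (hξ : IsFairScenery P ξ) :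
    iIndepFun (fun (k : ℤ) ω =>
      sceneryWalk (fun k => ξ k ω) (k + 1) - sceneryWalk (fun k => ξ k ω) k) P := by
  have hset : iIndepSet (fun k => {ω | sceneryWalk (fun k => ξ k ω) (k + 1) -
      sceneryWalk (fun k => ξ k ω) k = 1}) P := by
    rw [iIndepSet_iff_meas_biInter hξ.measurableSet_step]
    intro s
    rw [hξ.measure_biInter_step s, Finset.prod_congr rfl fun k _ => (hξ.measure_step k).1]
    simp
  have h := (hset.iIndepFun_indicator (β := ℤ)).comp (fun _ x => 2 * x - 1)
    fun _ => measurable_from_top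
  convert h using 2 with k
  ext ω
  exact sceneryWalk_step_eq_indicator (fun k => ξ k ω) k

/-- The two halves of the representation of a fair scenery are simple random walks. -/
theorem isSimpleRandomWalk (hξ : IsFairScenery P ξ) {ε : ℤ} (hε : ε = 1 ∨ ε = -1) :
    IsSimpleRandomWalk P fun (k : ℕ) ω => sceneryWalk (fun k => ξ k ω) (ε * k) where
  measurable k := measurable_pi_iff.1 hξ.measurable_sceneryWalk _
  start := Filter.Eventually.of_forall fun ω => by simp [(sceneryWalk_spec _).2.1]
  indep := by
    rcases hε with rfl | rfl
    · have := hξ.iIndepFun_step.precomp (g := fun k : ℕ => (k : ℤ)) Nat.cast_injective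
      simpa [Function.comp_def] using this
    · have := (hξ.iIndepFun_step.comp (fun _ x => -x) fun _ => measurable_neg).precomp
        (g := fun k : ℕ => -((k : ℤ) + 1)) fun a b h => by simpa using h
      convert this using 2 with k
      ext ω
      have e : -((k : ℤ) + 1) + 1 = -1 * k := by ring
      have e' : -((k : ℤ) + 1) = -1 * ((k + 1 : ℕ) : ℤ) := by push_cast; ring
      simp only [Function.comp_apply]
      rw [e, e']
      ring
  step_right k := by
    rcases hε with rfl | rfl
    · simpa using (hξ.measure_step k).1
    · rw [← (hξ.measure_step (-((k : ℤ) + 1))).2]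
      congr 1
      ext ω
      have e : -((k : ℤ) + 1) + 1 = -1 * k := by ring
      have e' : -((k : ℤ) + 1) = -1 * ((k + 1 : ℕ) : ℤ) := by push_cast; ring
      simp only [Set.mem_ofPred_eq]
      rw [e, e']
      omega
  step_left k := by
    rcases hε with rfl | rfl
    · simpa using (hξ.measure_step k).2
    · rw [← (hξ.measure_step (-((k : ℤ) + 1))).1]
      congr 1
      ext ω
      have e : -((k : ℤ) + 1) + 1 = -1 * k := by ring
      have e' : -((k : ℤ) + 1) = -1 * ((k + 1 : ℕ) : ℤ) := by push_cast; ring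
      simp only [Set.mem_ofPred_eq]
      rw [e, e']
      omega

/-- The two halves of the representation of a fair scenery are independent. -/
theorem indepFun_sceneryWalk (hξ : IsFairScenery P ξ) :
    IndepFun (fun ω (k : ℕ) => sceneryWalk (fun k => ξ k ω) (1 * k))
      (fun ω (k : ℕ) => sceneryWalk (fun k => ξ k ω) (-1 * k)) P := by
  have hdisj : Disjoint (Set.Ici (0 : ℤ)) (Set.Iio 0) :=
    Set.disjoint_left.2 fun x h1 h2 => absurd (Set.mem_Ici.1 h1) (not_le.2 h2)
  have h := hξ.iIndepFun_step.indepFun_subtype hξ.measurable_step hdisj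
  have h1 : ∀ i : ℕ, (i : ℤ) ∈ Set.Ici (0 : ℤ) := fun i => Int.natCast_nonneg i
  have h2 : ∀ i : ℕ, -((i : ℤ) + 1) ∈ Set.Iio (0 : ℤ) := fun i => by rw [Set.mem_Iio]; omega
  have m1 : Measurable fun (x : Set.Ici (0 : ℤ) → ℤ) => pathOfSteps fun i => x ⟨i, h1 i⟩ :=
    measurable_pathOfSteps.comp (by fun_prop)
  have m2 : Measurable fun (x : Set.Iio (0 : ℤ) → ℤ) =>
      pathOfSteps fun i => -x ⟨-((i : ℤ) + 1), h2 i⟩ :=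
    measurable_pathOfSteps.comp (by fun_prop)
  have h' := h.comp m1 m2
  convert h' using 1
  · funext ω
    simp only [one_mul]
    exact sceneryWalk_nat_eq _
  · funext ω
    simp only [neg_one_mul]
    exact sceneryWalk_neg_eq _

end IsFairScenery

/-! ### Crossings by the two halves of a two-sided path -/

/-- The half of the path `R` indexed by `0, ε, 2ε, …`. -/
def halfPath (R : ℤ → ℤ) (ε : ℤ) (k : ℕ) : ℤ := R (ε * k)

/-- The pair of the times `ε * t₁` and `ε * t₂`. -/
def signedTimes (ε : ℤ) (t : ℕ × ℕ) : ℤ × ℤ := (ε * t.1, ε * t.2)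

theorem isCrossing_signedTimes_iff {R : ℤ → ℤ} {ε : ℤ} (hε : ε = 1 ∨ ε = -1) {x₁ x₂ : ℤ}
    {t : ℕ × ℕ} :
    IsCrossing R x₁ x₂ (signedTimes ε t) ↔ IsCrossing (halfPath R ε) x₁ x₂ t := by
  unfold IsCrossing halfPath signedTimes
  refine and_congr_right fun _ => and_congr_right fun _ => and_congr_right fun _ => ?_
  constructor
  · intro h s h1 h2
    refine h _ ?_ ?_ <;> rcases hε with rfl | rfl <;> dsimp only <;> omega
  · intro h s h1 h2
    dsimp only at h1 h2
    have hs : s = ε * (s.natAbs : ℤ) := by rcases hε with rfl | rfl <;> omega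
    rw [hs]
    refine h _ ?_ ?_ <;> rcases hε with rfl | rfl <;> omega

theorem signedTimes_injective {ε : ℤ} (hε : ε = 1 ∨ ε = -1) :
    Function.Injective (signedTimes ε) := fun s t h => by
  simp only [signedTimes, Prod.mk.injEq] at h
  rcases hε with rfl | rfl <;> ext <;> omega

theorem sign_eq_one_or {z : ℤ} (hz : z ≠ 0) : z.sign = 1 ∨ z.sign = -1 := by
  rcases lt_or_gt_of_ne hz with h | h
  · exact Or.inr (Int.sign_eq_neg_one_of_neg h)
  · exact Or.inl (Int.sign_eq_one_of_pos h)

/-- Multiplying times by the sign of `z` carries one half of R to a path on ℕ, so the results on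
numbered crossings apply to both halves. -/
theorem isSignedCrossing_iff {R : ℤ → ℤ} {x₁ x₂ z : ℤ} (hz : z ≠ 0) {k : ℤ × ℤ} :
    IsSignedCrossing R x₁ x₂ z k ↔
      ∃ t, k = signedTimes z.sign t ∧ IsNthCrossing (halfPath R z.sign) x₁ x₂ z.natAbs t := by
  have hinj := signedTimes_injective (sign_eq_one_or hz)
  have hcr : ∀ t, IsCrossing R x₁ x₂ (signedTimes z.sign t) ↔
      IsCrossing (halfPath R z.sign) x₁ x₂ t := fun t =>
    isCrossing_signedTimes_iff (sign_eq_one_or hz)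
  rcases lt_or_gt_of_ne hz with h | h
  · have hs := Int.sign_eq_neg_one_of_neg h
    rw [hs] at hinj hcr ⊢
    have hset : ∀ t : ℕ × ℕ, {s : ℤ × ℤ | IsCrossing R x₁ x₂ s ∧ max s.1 s.2 ≤ 0 ∧
        max (signedTimes (-1) t).1 (signedTimes (-1) t).2 ≤ min s.1 s.2} =
        signedTimes (-1) '' {s : ℕ × ℕ | IsCrossing (halfPath R (-1)) x₁ x₂ s ∧
          max s.1 s.2 ≤ min t.1 t.2} := by
      intro t
      ext s
      constructor
      · rintro ⟨h1, h2, h3⟩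
        have e : s = signedTimes (-1) (s.1.natAbs, s.2.natAbs) := by
          unfold signedTimes
          ext <;> dsimp only <;> omega
        refine ⟨(s.1.natAbs, s.2.natAbs), ⟨(hcr _).1 (by rwa [← e]), ?_⟩, e.symm⟩
        dsimp only [signedTimes] at h3 ⊢
        omega
      · rintro ⟨s, ⟨h1, h2⟩, rfl⟩
        refine ⟨(hcr s).2 h1, ?_, ?_⟩ <;> dsimp only [signedTimes] <;> omega
    constructor
    · rintro ⟨h1, ⟨h2, -⟩ | ⟨-, h2, h3, h4⟩⟩
      · omega
      · have e : k = signedTimes (-1) (k.1.natAbs, k.2.natAbs) := by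
          unfold signedTimes
          ext <;> dsimp only <;> omega
        refine ⟨_, e, (hcr _).1 (by rwa [← e]), ?_⟩
        rw [← hinj.encard_image, ← hset, ← e]
        exact h4
    · rintro ⟨t, rfl, h1, h2⟩
      refine ⟨(hcr t).2 h1, Or.inr ⟨h, ?_, ?_, ?_⟩⟩
      · dsimp only [signedTimes]
        omega
      · dsimp only [signedTimes]
        omega
      · rw [hset, hinj.encard_image]
        exact h2
  · have hs := Int.sign_eq_one_of_pos h
    rw [hs] at hinj hcr ⊢
    have hset : ∀ t : ℕ × ℕ, {s : ℤ × ℤ | IsCrossing R x₁ x₂ s ∧ 0 ≤ min s.1 s.2 ∧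
        max s.1 s.2 ≤ min (signedTimes 1 t).1 (signedTimes 1 t).2} =
        signedTimes 1 '' {s : ℕ × ℕ | IsCrossing (halfPath R 1) x₁ x₂ s ∧
          max s.1 s.2 ≤ min t.1 t.2} := by
      intro t
      ext s
      constructor
      · rintro ⟨h1, h2, h3⟩
        have e : s = signedTimes 1 (s.1.natAbs, s.2.natAbs) := by
          unfold signedTimes
          ext <;> dsimp only <;> omega
        refine ⟨(s.1.natAbs, s.2.natAbs), ⟨(hcr _).1 (by rwa [← e]), ?_⟩, e.symm⟩
        dsimp only [signedTimes] at h3 ⊢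
        omega
      · rintro ⟨s, ⟨h1, h2⟩, rfl⟩
        refine ⟨(hcr s).2 h1, ?_, ?_⟩ <;> dsimp only [signedTimes] <;> omega
    constructor
    · rintro ⟨h1, ⟨-, h2, h3, h4⟩ | ⟨h2, -⟩⟩
      · have e : k = signedTimes 1 (k.1.natAbs, k.2.natAbs) := by
          unfold signedTimes
          ext <;> dsimp only <;> omega
        refine ⟨_, e, (hcr _).1 (by rwa [← e]), ?_⟩
        rw [← hinj.encard_image, ← hset, ← e]
        exact h4
      · omega
    · rintro ⟨t, rfl, h1, h2⟩
      refine ⟨(hcr t).2 h1, Or.inl ⟨h, ?_, ?_, ?_⟩⟩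
      · dsimp only [signedTimes]
        omega
      · dsimp only [signedTimes]
        omega
      · rw [hset, hinj.encard_image]
        exact h2

theorem IsSignedCrossing.unique {R : ℤ → ℤ} {x₁ x₂ z : ℤ} (hz : z ≠ 0) {k k' : ℤ × ℤ}
    (h : IsSignedCrossing R x₁ x₂ z k) (h' : IsSignedCrossing R x₁ x₂ z k') : k = k' := by
  obtain ⟨t, rfl, ht⟩ := (isSignedCrossing_iff hz).1 h
  obtain ⟨t', rfl, ht'⟩ := (isSignedCrossing_iff hz).1 h'
  rw [ht.unique ht']

theorem IsSignedCrossing.index_unique {R : ℤ → ℤ} {x₁ x₂ z z' : ℤ} {k : ℤ × ℤ}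
    (h : IsSignedCrossing R x₁ x₂ z k) (h' : IsSignedCrossing R x₁ x₂ z' k) : z = z' := by
  have hne := h.1.fst_ne_snd
  obtain ⟨-, ⟨a1, a2, a3, a4⟩ | ⟨a1, a2, a3, a4⟩⟩ := h <;>
    obtain ⟨-, ⟨b1, b2, b3, b4⟩ | ⟨b1, b2, b3, b4⟩⟩ := h'
  · have : z.natAbs = z'.natAbs := by exact_mod_cast a4.symm.trans b4
    omega
  · omega
  · omega
  · have : z.natAbs = z'.natAbs := by exact_mod_cast a4.symm.trans b4
    omega

theorem IsIndexedCrossing.unique {R : ℤ → ℤ} {S : ℕ → ℤ} {n i : ℕ} {z : ℤ} (hz : z ≠ 0)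
    {t t' : ℕ × ℕ} (h : IsIndexedCrossing R S n i z t) (h' : IsIndexedCrossing R S n i z t') :
    t = t' := by
  obtain ⟨k, h1, h2⟩ := h
  obtain ⟨k', h1', h2'⟩ := h'
  obtain rfl := h1.unique hz h1'
  exact h2.unique h2'

/-! ### Crossings by a composition of paths -/

theorem IsCrossing.apply_mem_uIcc {T : ℕ → ℤ} {x₁ x₂ : ℤ} {t : ℕ × ℕ} (ht : IsCrossing T x₁ x₂ t)
    {u : ℕ} (hu : u ∈ Set.uIcc t.1 t.2) : T u ∈ Set.uIcc x₁ x₂ := by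
  by_cases h : min t.1 t.2 < u ∧ u < max t.1 t.2
  · have := ht.2.2.2 u h.1 h.2
    rw [Set.mem_uIcc]
    omega
  · rw [Set.mem_uIcc] at hu
    have : u = t.1 ∨ u = t.2 := by omega
    rcases this with rfl | rfl
    · rw [ht.2.1]
      exact Set.left_mem_uIcc
    · rw [ht.2.2.1]
      exact Set.right_mem_uIcc

theorem IsCrossing.comp {R : ℤ → ℤ} {S : ℕ → ℤ} {x₁ x₂ : ℤ} {k : ℤ × ℤ} {t : ℕ × ℕ}
    (hk : IsCrossing R x₁ x₂ k) (ht : IsCrossing S k.1 k.2 t) :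
    IsCrossing (fun u => R (S u)) x₁ x₂ t := by
  refine ⟨hk.1, ?_, ?_, fun s h1 h2 => ?_⟩
  · beta_reduce
    rw [ht.2.1, hk.2.1]
  · beta_reduce
    rw [ht.2.2.1, hk.2.2.1]
  · obtain ⟨h3, h4⟩ := ht.2.2.2 s h1 h2
    exact hk.2.2.2 _ h3 h4

theorem signed_mem_uIcc {ε : ℤ} (hε : ε = 1 ∨ ε = -1) {a b c : ℕ} :
    ε * (c : ℤ) ∈ Set.uIcc (ε * (a : ℤ)) (ε * (b : ℤ)) ↔ c ∈ Set.uIcc a b := by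
  rw [Set.mem_uIcc, Set.mem_uIcc]
  rcases hε with rfl | rfl <;> omega

/-- The first crossing by `R ∘ S` of `(x₁, x₂)` is the first crossing by `S` of the first crossing
by `R` of `(x₁, x₂)`. -/
theorem IsFirstCrossingDuring.comp {R : ℤ → ℤ} {S : ℕ → ℤ} {ε : ℤ} (hε : ε = 1 ∨ ε = -1)
    (hR : IsNearestNeighbor (halfPath R ε)) (hS : IsNearestNeighbor S) {y₁ y₂ x₁ x₂ : ℤ}
    {k j t s : ℕ × ℕ} (hk : IsCrossing (halfPath R ε) y₁ y₂ k) (hx : x₁ ∈ Set.uIcc y₁ x₂)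
    (hj : IsFirstCrossingDuring (halfPath R ε) x₁ x₂ k j)
    (ht : IsCrossing S (ε * k.1) (ε * k.2) t)
    (hs : IsFirstCrossingDuring S (ε * j.1) (ε * j.2) t s) :
    IsFirstCrossingDuring (fun u => R (S u)) x₁ x₂ t s := by
  obtain ⟨a1, a2⟩ := hj.eq_snd_of_apply_eq hR (by rwa [hk.2.1])
  obtain ⟨b1, b2⟩ := hs.eq_snd_of_apply_eq hS (by rw [ht.2.1]; exact (signed_mem_uIcc hε).2 a1)
  have hjc : IsCrossing R x₁ x₂ (signedTimes ε j) := (isCrossing_signedTimes_iff hε).2 hj.1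
  have hc : IsCrossing (fun u => R (S u)) x₁ x₂ s := hjc.comp hs.1
  refine isFirstCrossingDuring_iff.2 ⟨hc, hs.2.1, hs.2.2.1, fun r hr h1 h2 => ?_⟩
  -- When R ∘ S is at `x₂`, the walk S is at a point not before `j.2` as seen from `k.1`. To get
  -- there it passes the point of `j.2`, which happens no earlier than `s.2`.
  have key : s.2 ∈ Set.uIcc t.1 r.2 := by
    have h3 := ht.apply_mem_uIcc h2
    obtain ⟨v, hv⟩ : ∃ v : ℕ, S r.2 = ε * v := by
      refine ⟨(S r.2).natAbs, ?_⟩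
      rw [Set.mem_uIcc] at h3
      rcases hε with rfl | rfl <;> omega
    rw [hv, signed_mem_uIcc hε] at h3
    have h4 : halfPath R ε v = x₂ := by
      have := hr.2.2.1
      simp only [hv] at this
      exact this
    have h5 : j.2 ∈ Set.uIcc k.1 v := by
      by_cases h : v ∈ Set.uIcc k.1 j.2
      · rw [a2 v h h4]
        exact Set.right_mem_uIcc
      · have h6 := hj.2.2.1
        rw [Set.mem_uIcc] at *
        omega
    rw [← signed_mem_uIcc hε, ← hv, ← ht.2.1] at h5
    obtain ⟨u, hu, hu'⟩ := hS.exists_eq h5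
    by_cases h : u ∈ Set.uIcc t.1 s.2
    · rwa [b2 u h hu'] at hu
    · have h6 := hs.2.2.1
      simp only [Set.mem_uIcc] at *
      omega
  refine ⟨?_, key⟩
  by_contra hcon
  have hne : s.1 ≠ r.2 := fun e => hr.1 (by rw [← hc.2.1, ← hr.2.2.1, e])
  -- If `r.1` came before `s.1`, then, as `r.2` does not come before `s.2`, the time `s.1` with
  -- value `x₁` would lie inside the crossing `r`.
  refine hr.not_mem_of_apply (u := s.1) (Or.inl hc.2.1) ?_
  have h7 := hs.2.1
  clear b2 a2 a1 hx
  simp only [Set.mem_uIcc] at *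
  rcases le_total t.1 t.2 with h | h <;> constructor <;> omega

/-! ### Number of events that occur among independent events -/

section Binomial

variable {Ω : Type*} [MeasurableSpace Ω] {P : Measure Ω} [IsProbabilityMeasure P]

/-- Inclusion and exclusion, one complement at a time: the probability for `A` and `insert b B` is
that for `A` and `B` minus that for `insert b A` and `B`. -/
theorem measureReal_forall_mem_forall_notMem {E : ℕ → Set Ω} (hE : ∀ m, MeasurableSet (E m)) {n : ℕ}
    {p : ℝ} (h : ∀ M ⊆ Finset.range n, P.real {ω | ∀ m ∈ M, ω ∈ E m} = p ^ M.card)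
    {A B : Finset ℕ} (hA : A ⊆ Finset.range n) (hB : B ⊆ Finset.range n) (hAB : Disjoint A B) :
    P.real {ω | (∀ m ∈ A, ω ∈ E m) ∧ ∀ m ∈ B, ω ∉ E m} = p ^ A.card * (1 - p) ^ B.card := by
  induction B using Finset.induction_on generalizing A with
  | empty => simpa using h A hA
  | insert b B hb ih =>
    rw [Finset.insert_subset_iff] at hB
    rw [Finset.disjoint_insert_right] at hAB
    have h1 := ih hA hB.2 hAB.2
    have h2 := ih (A := insert b A) (Finset.insert_subset hB.1 hA) hB.2
      (Finset.disjoint_insert_left.2 ⟨hb, hAB.2⟩)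
    rw [Finset.card_insert_of_notMem hAB.1] at h2
    have h3 := measureReal_inter_add_sdiff (μ := P)
      (s := {ω | (∀ m ∈ A, ω ∈ E m) ∧ ∀ m ∈ B, ω ∉ E m}) (hE b)
    have e1 : {ω | (∀ m ∈ A, ω ∈ E m) ∧ ∀ m ∈ B, ω ∉ E m} ∩ E b =
        {ω | (∀ m ∈ insert b A, ω ∈ E m) ∧ ∀ m ∈ B, ω ∉ E m} := by
      ext ω
      simp only [Set.mem_inter_iff, Set.mem_ofPred_eq, Finset.mem_insert, forall_eq_or_imp]
      tauto
    have e2 : {ω | (∀ m ∈ A, ω ∈ E m) ∧ ∀ m ∈ B, ω ∉ E m} \ E b =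
        {ω | (∀ m ∈ A, ω ∈ E m) ∧ ∀ m ∈ insert b B, ω ∉ E m} := by
      ext ω
      simp only [Set.mem_sdiff, Set.mem_ofPred_eq, Finset.mem_insert, forall_eq_or_imp]
      tauto
    rw [e1, e2, h1, h2] at h3
    rw [Finset.card_insert_of_notMem hb, pow_succ, ← add_right_inj, h3]
    ring

open Classical in
/-- The number of events that occur among `n` independent events of probability `p` has a binomial
distribution. -/
theorem hasLaw_binomial_of_measure_inter {E : ℕ → Set Ω} (hE : ∀ m, MeasurableSet (E m)) {n : ℕ}
    {p : unitInterval}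
    (h : ∀ M ⊆ Finset.range n, P.real {ω | ∀ m ∈ M, ω ∈ E m} = (p : ℝ) ^ M.card) :
    HasLaw (fun ω => ((Finset.range n).filter fun m => ω ∈ E m).card) (binomial n p) P := by
  have hset : ∀ k, {ω | ((Finset.range n).filter fun m => ω ∈ E m).card = k} =
      ⋃ A ∈ Finset.powersetCard k (Finset.range n),
        {ω | (∀ m ∈ A, ω ∈ E m) ∧ ∀ m ∈ Finset.range n \ A, ω ∉ E m} := by
    intro k
    ext ω
    simp only [Set.mem_ofPred_eq, Set.mem_iUnion, exists_prop, Finset.mem_powersetCard]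
    constructor
    · intro hk
      refine ⟨_, ⟨Finset.filter_subset _ _, hk⟩, fun m hm => (Finset.mem_filter.1 hm).2,
        fun m hm => ?_⟩
      rw [Finset.mem_sdiff, Finset.mem_filter] at hm
      tauto
    · rintro ⟨A, ⟨h1, h2⟩, h3, h4⟩
      rw [← h2]
      congr 1
      ext m
      rw [Finset.mem_filter]
      refine ⟨fun hm => ?_, fun hm => ⟨h1 hm, h3 m hm⟩⟩
      by_contra hc
      exact h4 m (Finset.mem_sdiff.2 ⟨hm.1, hc⟩) hm.2
  have hmA : ∀ A B : Finset ℕ, MeasurableSet {ω | (∀ m ∈ A, ω ∈ E m) ∧ ∀ m ∈ B, ω ∉ E m} := by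
    intro A B
    have : {ω | (∀ m ∈ A, ω ∈ E m) ∧ ∀ m ∈ B, ω ∉ E m} =
        (⋂ m ∈ A, E m) ∩ ⋂ m ∈ B, (E m)ᶜ := by ext; simp
    rw [this]
    exact (Finset.measurableSet_biInter _ fun m _ => hE m).inter
      (Finset.measurableSet_biInter _ fun m _ => (hE m).compl)
  have hmeas : Measurable fun ω => ((Finset.range n).filter fun m => ω ∈ E m).card := by
    refine measurable_to_countable' fun k => ?_
    change MeasurableSet {ω | ((Finset.range n).filter fun m => ω ∈ E m).card = k}
    rw [hset]
    exact Finset.measurableSet_biUnion _ fun A _ => hmA A _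
  refine ⟨hmeas.aemeasurable, ?_⟩
  have := Measure.isProbabilityMeasure_map hmeas.aemeasurable (μ := P)
  refine Measure.ext_of_measureReal_singleton fun k => ?_
  rw [map_measureReal_apply hmeas (measurableSet_singleton k), binomial_real_singleton]
  change P.real {ω | ((Finset.range n).filter fun m => ω ∈ E m).card = k} = _
  rw [hset, measureReal_biUnion_finset (fun A hA B hB hne => ?_) fun A _ => hmA A _]
  · rw [Finset.sum_congr rfl fun A hA => ?_, Finset.sum_const, Finset.card_powersetCard,
      Finset.card_range, nsmul_eq_mul, mul_assoc]
    obtain ⟨h1, h2⟩ := Finset.mem_powersetCard.1 hA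
    rw [measureReal_forall_mem_forall_notMem hE h h1 Finset.sdiff_subset Finset.disjoint_sdiff,
      Finset.card_sdiff_of_subset h1, h2, Finset.card_range]
  · refine Set.disjoint_left.2 fun ω h1 h2 => hne ?_
    obtain ⟨hA', -⟩ := Finset.mem_powersetCard.1 hA
    obtain ⟨hB', -⟩ := Finset.mem_powersetCard.1 hB
    ext m
    constructor
    · intro hm
      by_contra hc
      exact h2.2 m (Finset.mem_sdiff.2 ⟨hA' hm, hc⟩) (h1.1 m hm)
    · intro hm
      by_contra hc
      exact h1.2 m (Finset.mem_sdiff.2 ⟨hB' hm, hc⟩) (h2.1 m hm)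

end Binomial

/-! ### The loci of the scenery and of the walk -/

/-- The label of the first crossing of `(3m, 3m + 3)` during the `|z|`-th crossing of `(0, 3n)`. -/
def sceneryLocus (n : ℕ) (z : ℤ) (m : ℕ) : LocusLabel := ⟨0, 3 * n, z.natAbs, 3 * m, 3 * m + 3⟩

/-- The label of the first crossing of `(ε * j₁, ε * j₂)` during the `i`-th crossing of
`(ε * k₁, ε * k₂)`. -/
def walkLocus (ε : ℤ) (i : ℕ) (k j : ℕ × ℕ) : LocusLabel :=
  ⟨ε * k.1, ε * k.2, i, ε * j.1, ε * j.2⟩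

/-- `k` is the `z`-th crossing by `R` of `(0, 3n)`, up to the sign of the times, and `j m` is the
first crossing by `R` of `(3m, 3m + 3)` during `k`. -/
structure IsCrossingData (R : ℤ → ℤ) (n : ℕ) (z : ℤ) (k : ℕ × ℕ) (j : ℕ → ℕ × ℕ) : Prop where
  ne_zero : z ≠ 0
  nth : IsNthCrossing (halfPath R z.sign) 0 (3 * n) z.natAbs k
  first : ∀ m < n, IsFirstCrossingDuring (halfPath R z.sign) (3 * m) (3 * m + 3) k (j m)

theorem exists_isCrossingData {R : ℤ → ℤ} {n : ℕ} (hn : 0 < n) {z : ℤ} (hz : z ≠ 0)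
    (h1 : IsNearestNeighbor (halfPath R z.sign)) (h2 : IsRecurrent (halfPath R z.sign)) :
    ∃ k j, IsCrossingData R n z k j := by
  obtain ⟨k, hk⟩ := h1.exists_isNthCrossing h2 (x₁ := 0) (x₂ := 3 * n) (by omega) (z.natAbs - 1)
  rw [Nat.sub_add_cancel (by omega)] at hk
  have hj : ∀ m : ℕ, ∃ j, m < n →
      IsFirstCrossingDuring (halfPath R z.sign) (3 * m) (3 * m + 3) k j := by
    intro m
    by_cases hm : m < n
    · obtain ⟨j, hj⟩ := h1.exists_isFirstCrossingDuring (x₁ := 3 * m) (x₂ := 3 * m + 3) (t := k)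
        (by omega) (by rw [hk.1.2.1, hk.1.2.2.1, Set.mem_uIcc]; omega)
        (by rw [hk.1.2.1, hk.1.2.2.1, Set.mem_uIcc]; omega)
      exact ⟨j, fun _ => hj⟩
    · exact ⟨(0, 0), fun h => absurd h hm⟩
  choose j hj using hj
  exact ⟨k, j, hz, hk, fun m hm => hj m hm⟩

namespace IsCrossingData

variable {R : ℤ → ℤ} {n : ℕ} {z : ℤ} {k : ℕ × ℕ} {j : ℕ → ℕ × ℕ}

theorem isSignedCrossing (h : IsCrossingData R n z k j) :
    IsSignedCrossing R 0 (3 * n) z (signedTimes z.sign k) :=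
  (isSignedCrossing_iff h.ne_zero).2 ⟨k, rfl, h.nth⟩

theorem isIndexedCrossing_iff (h : IsCrossingData R n z k j) {S : ℕ → ℤ} {i : ℕ} {t : ℕ × ℕ} :
    IsIndexedCrossing R S n i z t ↔ IsNthCrossing S (z.sign * k.1) (z.sign * k.2) i t := by
  constructor
  · rintro ⟨k', h1, h2⟩
    obtain rfl := h1.unique h.ne_zero h.isSignedCrossing
    exact h2
  · exact fun ht => ⟨_, h.isSignedCrossing, ht⟩

theorem isCrossing_first (h : IsCrossingData R n z k j) {m : ℕ} (hm : m < n) :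
    IsCrossing R (3 * m) (3 * m + 3) (signedTimes z.sign (j m)) :=
  (isCrossing_signedTimes_iff (sign_eq_one_or h.ne_zero)).2 (h.first m hm).1

theorem isStraightLocus_iff (h : IsCrossingData R n z k j) {m : ℕ} (hm : m < n) :
    IsStraightLocus (halfPath R z.sign) (sceneryLocus n z m) ↔
      |((j m).1 : ℤ) - (j m).2| = 3 := by
  have hl : IsLocus (halfPath R z.sign) (sceneryLocus n z m) (j m) := ⟨k, h.nth, h.first m hm⟩
  have e : |(sceneryLocus n z m).j₁ - (sceneryLocus n z m).j₂| = 3 := by simp [sceneryLocus]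
  unfold IsStraightLocus
  rw [e]
  constructor
  · rintro ⟨s, hs, h3⟩
    rwa [hl.unique hs]
  · exact fun h3 => ⟨_, hl, h3⟩

theorem first_mem_uIcc (h : IsCrossingData R n z k j) {m : ℕ} (hm : m < n) :
    z.sign * ((j m).1 : ℤ) ∈ Set.uIcc (z.sign * (k.1 : ℤ)) (z.sign * (k.2 : ℤ)) ∧
      z.sign * ((j m).2 : ℤ) ∈ Set.uIcc (z.sign * (k.1 : ℤ)) (z.sign * (k.2 : ℤ)) :=
  ⟨(signed_mem_uIcc (sign_eq_one_or h.ne_zero)).2 (h.first m hm).2.1,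
    (signed_mem_uIcc (sign_eq_one_or h.ne_zero)).2 (h.first m hm).2.2.1⟩

theorem abs_signed_sub (h : IsCrossingData R n z k j) (m : ℕ) :
    |z.sign * ((j m).1 : ℤ) - z.sign * (j m).2| = |((j m).1 : ℤ) - (j m).2| := by
  rcases sign_eq_one_or h.ne_zero with e | e <;> rw [e]
  · simp
  · rw [← mul_sub, abs_mul]
    simp

theorem signed_ne (h : IsCrossingData R n z k j) :
    z.sign * (k.1 : ℤ) ≠ z.sign * (k.2 : ℤ) := h.isSignedCrossing.1.fst_ne_snd

theorem signed_first_ne (h : IsCrossingData R n z k j) {m : ℕ} (hm : m < n) :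
    z.sign * ((j m).1 : ℤ) ≠ z.sign * ((j m).2 : ℤ) := (h.isCrossing_first hm).fst_ne_snd

/-- The crossing by S lasts at least as long as the crossing by R that it traverses, and the latter
lasts at least three steps. The total is three if and only if both inequalities are equalities. -/
theorem straightBit_eq_one_iff (h : IsCrossingData R n z k j)
    (hR : IsNearestNeighbor (halfPath R z.sign)) {S : ℕ → ℤ} (hS : IsNearestNeighbor S) {i : ℕ}
    {t : ℕ × ℕ} (ht : IsIndexedCrossing R S n i z t) {m : ℕ} (hm : m < n) :
    straightBit (fun u => R (S u)) t m = 1 ↔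
      IsStraightLocus (halfPath R z.sign) (sceneryLocus n z m) ∧
        IsStraightLocus S (walkLocus z.sign i k (j m)) := by
  rw [h.isIndexedCrossing_iff] at ht
  rw [h.isStraightLocus_iff hm]
  obtain ⟨hj1, hj2⟩ := h.first_mem_uIcc hm
  obtain ⟨s, hs⟩ := hS.exists_isFirstCrossingDuring (t := t) (h.signed_first_ne hm)
    (by rwa [ht.1.2.1, ht.1.2.2.1]) (by rwa [ht.1.2.1, ht.1.2.2.1])
  have hc := IsFirstCrossingDuring.comp (sign_eq_one_or h.ne_zero) hR hS h.nth.1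
    (by rw [Set.mem_uIcc]; omega) (h.first m hm) ht.1 hs
  have hl : IsLocus S (walkLocus z.sign i k (j m)) s := ⟨t, ht, hs⟩
  have e1 : |(3 * m : ℤ) - (3 * m + 3)| = 3 := by simp
  have e2 : straightBit (fun u => R (S u)) t m = 1 ↔ |(s.1 : ℤ) - s.2| = 3 := by
    unfold straightBit
    rw [e1]
    constructor
    · intro h'
      split_ifs at h' with h''
      · obtain ⟨r, hr, hr'⟩ := h''
        rwa [hc.unique hr]
    · intro h'
      rw [if_pos ⟨s, hc, h'⟩]
  have e3 : IsStraightLocus S (walkLocus z.sign i k (j m)) ↔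
      |(s.1 : ℤ) - s.2| = |((j m).1 : ℤ) - (j m).2| := by
    rw [← h.abs_signed_sub m]
    constructor
    · rintro ⟨r, hr, hr'⟩
      rwa [hl.unique hr]
    · exact fun h' => ⟨s, hl, h'⟩
  have h1 := hS.abs_sub_le s.1 s.2
  rw [hs.1.2.1, hs.1.2.2.1, h.abs_signed_sub m] at h1
  have h2 := hR.abs_sub_le (j m).1 (j m).2
  rw [(h.first m hm).1.2.1, (h.first m hm).1.2.2.1, e1] at h2
  rw [e2, e3]
  omega

/-- Inner points of the crossing are mapped by R strictly between `3m` and `3m + 3`, hence not to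
multiples of 3. All endpoints occurring in the labels are mapped to multiples of 3. -/
theorem avoids (h : IsCrossingData R n z k j) {m : ℕ} (hm : m < n) (i : ℕ) {x : ℤ}
    (hx : R x % 3 = 0) : (walkLocus z.sign i k (j m)).Avoids x := by
  rintro ⟨h1, h2⟩
  have := (h.isCrossing_first hm).2.2.2 x h1 h2
  omega

theorem avoidsAll (h : IsCrossingData R n z k j) {m : ℕ} (hm : m < n) (i : ℕ) {z' : ℤ}
    {k' : ℕ × ℕ} {j' : ℕ → ℕ × ℕ} (h' : IsCrossingData R n z' k' j') {m' : ℕ} (hm' : m' < n)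
    (i' : ℕ) :
    (walkLocus z.sign i k (j m)).AvoidsAll (walkLocus z'.sign i' k' (j' m')) := by
  have h1 := h'.isSignedCrossing.1
  have h2 := h'.isCrossing_first hm'
  refine ⟨h.avoids hm i ?_, h.avoids hm i ?_, h.avoids hm i ?_, h.avoids hm i ?_⟩
  · have : R (walkLocus z'.sign i' k' (j' m')).k₁ = _ := h1.2.1
    rw [this]
    omega
  · have : R (walkLocus z'.sign i' k' (j' m')).k₂ = _ := h1.2.2.1
    rw [this]
    omega
  · have : R (walkLocus z'.sign i' k' (j' m')).j₁ = _ := h2.2.1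
    rw [this]
    omega
  · have : R (walkLocus z'.sign i' k' (j' m')).j₂ = _ := h2.2.2.1
    rw [this]
    omega

/-- For `m ≠ m'` the values of R at the inner points differ. For `m = m'` and `z ≠ z'` the loci lie
in different crossings by R, which do not overlap. In the remaining case only the numbers `i` and
`i'` differ. -/
theorem separated (h : IsCrossingData R n z k j) {m : ℕ} (hm : m < n) {i : ℕ} {z' : ℤ}
    {k' : ℕ × ℕ} {j' : ℕ → ℕ × ℕ} (h' : IsCrossingData R n z' k' j') {m' : ℕ} (hm' : m' < n)
    {i' : ℕ} (hne : m = m' → (i, z) ≠ (i', z')) :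
    (walkLocus z.sign i k (j m)).Separated (walkLocus z'.sign i' k' (j' m')) := by
  by_cases hmm : m = m'
  · subst hmm
    by_cases hz : z = z'
    · subst hz
      obtain rfl := h.nth.unique h'.nth
      refine Or.inr ⟨rfl, rfl, fun e => hne rfl (by rw [show i = i' from e]), ?_, ?_⟩ <;>
        simp only [walkLocus, (h.first m hm).unique (h'.first m hm)]
    · refine Or.inl fun x => ?_
      by_contra! hc
      obtain ⟨h1, h2⟩ := hc
      unfold LocusLabel.Avoids walkLocus at h1 h2
      push Not at h1 h2
      obtain ⟨a1, a2⟩ := h.first_mem_uIcc hm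
      obtain ⟨b1, b2⟩ := h'.first_mem_uIcc hm'
      rw [Set.mem_uIcc] at a1 a2 b1 b2
      have e := h.isSignedCrossing.1.eq_of_overlap h'.isSignedCrossing.1
        (by dsimp only [signedTimes] at *; omega) (by dsimp only [signedTimes] at *; omega)
      have h3 := h.isSignedCrossing
      rw [e] at h3
      exact hz (h3.index_unique h'.isSignedCrossing)
  · refine Or.inl fun x => ?_
    by_contra! hc
    obtain ⟨h1, h2⟩ := hc
    have h3 := (h.isCrossing_first hm).2.2.2 x (not_not.1 h1).1 (not_not.1 h1).2
    have h4 := (h'.isCrossing_first hm').2.2.2 x (not_not.1 h2).1 (not_not.1 h2).2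
    omega

end IsCrossingData

/-! ### Probabilities of straight loci -/

section Loci

variable {Ω : Type*} [MeasurableSpace Ω] {P : Measure Ω} [IsProbabilityMeasure P]

theorem IsSimpleRandomWalk.measure_walkLocus {S : ℕ → Ω → ℤ} (hS : IsSimpleRandomWalk P S)
    {r : ℤ → ℤ} {n : ℕ} {za zb : ℤ} {ka kb : ℕ × ℕ} {ja jb : ℕ → ℕ × ℕ}
    (ha : IsCrossingData r n za ka ja) (hb : IsCrossingData r n zb kb jb) {ia ib : ℕ}
    (hia : 0 < ia) (hib : 0 < ib) (hab : (ia, za) ≠ (ib, zb)) {M : Finset ℕ}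
    (hM : M ⊆ Finset.range n) (h3a : ∀ m ∈ M, |((ja m).1 : ℤ) - (ja m).2| = 3)
    (h3b : ∀ m ∈ M, |((jb m).1 : ℤ) - (jb m).2| = 3) :
    P {ω | ∀ m ∈ M, IsStraightLocus (fun k => S k ω) (walkLocus za.sign ia ka (ja m)) ∧
      IsStraightLocus (fun k => S k ω) (walkLocus zb.sign ib kb (jb m))} =
      (3 / 4) ^ (2 * M.card) := by
  have hlt : ∀ m ∈ M, m < n := fun m hm => Finset.mem_range.1 (hM hm)
  let l : ℕ × Bool → LocusLabel := fun b =>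
    if b.2 then walkLocus za.sign ia ka (ja b.1) else walkLocus zb.sign ib kb (jb b.1)
  have h := hS.measure_forall_isStraightLocus l (M ×ˢ Finset.univ) ?_ ?_ ?_ ?_ ?_ ?_ ?_
  · rw [Finset.card_product, Finset.card_univ, Fintype.card_bool, mul_comm] at h
    rw [← h]
    congr 1
    ext ω
    simp only [Set.mem_ofPred_eq, Finset.mem_product, Finset.mem_univ, and_true, Prod.forall,
      Bool.forall_bool, l, if_true, if_false, Bool.false_eq_true]
    exact forall_congr' fun m => by tauto
  all_goals simp only [Finset.mem_product, Finset.mem_univ, and_true, Prod.forall, Bool.forall_bool,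
    l, if_true, if_false, Bool.false_eq_true]
  · exact fun m => ⟨fun _ => hib, fun _ => hia⟩
  · exact fun m => ⟨fun _ => hb.signed_ne, fun _ => ha.signed_ne⟩
  · exact fun m => ⟨fun hm => (hb.abs_signed_sub m).trans (h3b m hm),
      fun hm => (ha.abs_signed_sub m).trans (h3a m hm)⟩
  · exact fun m => ⟨fun hm => (hb.first_mem_uIcc (hlt m hm)).1,
      fun hm => (ha.first_mem_uIcc (hlt m hm)).1⟩
  · exact fun m => ⟨fun hm => (hb.first_mem_uIcc (hlt m hm)).2,
      fun hm => (ha.first_mem_uIcc (hlt m hm)).2⟩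
  · exact fun m => ⟨fun hm m' => ⟨fun hm' => hb.avoidsAll (hlt m hm) _ hb (hlt m' hm') _,
        fun hm' => hb.avoidsAll (hlt m hm) _ ha (hlt m' hm') _⟩,
      fun hm m' => ⟨fun hm' => ha.avoidsAll (hlt m hm) _ hb (hlt m' hm') _,
        fun hm' => ha.avoidsAll (hlt m hm) _ ha (hlt m' hm') _⟩⟩
  · exact fun m => ⟨fun hm m' =>
        ⟨fun hm' hne => hb.separated (hlt m hm) hb (hlt m' hm') fun e => by simp [e] at hne,
        fun hm' _ => hb.separated (hlt m hm) ha (hlt m' hm') fun _ => hab.symm⟩,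
      fun hm m' => ⟨fun hm' _ => ha.separated (hlt m hm) hb (hlt m' hm') fun _ => hab,
        fun hm' hne => ha.separated (hlt m hm) ha (hlt m' hm') fun e => by simp [e] at hne⟩⟩

theorem sceneryLocus_avoidsAll (n : ℕ) (z z' : ℤ) (m m' : ℕ) :
    (sceneryLocus n z m).AvoidsAll (sceneryLocus n z' m') := by
  refine ⟨?_, ?_, ?_, ?_⟩ <;> unfold LocusLabel.Avoids sceneryLocus <;> dsimp only <;> omega

theorem sceneryLocus_separated (n : ℕ) {z z' : ℤ} {m m' : ℕ}
    (h : m = m' → z.natAbs ≠ z'.natAbs) :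
    (sceneryLocus n z m).Separated (sceneryLocus n z' m') := by
  by_cases e : m = m'
  · subst e
    exact Or.inr ⟨rfl, rfl, h rfl, rfl, rfl⟩
  · refine Or.inl fun x => ?_
    unfold LocusLabel.Avoids sceneryLocus
    dsimp only
    omega

theorem IsSimpleRandomWalk.measure_sceneryLocus {S : ℕ → Ω → ℤ} (hS : IsSimpleRandomWalk P S)
    {n : ℕ} {z : ℤ} (hz : z ≠ 0) {M : Finset ℕ} (hM : M ⊆ Finset.range n) :
    P {ω | ∀ m ∈ M, IsStraightLocus (fun k => S k ω) (sceneryLocus n z m)} =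
      (3 / 4) ^ M.card := by
  have hlt : ∀ m ∈ M, m < n := fun m hm => Finset.mem_range.1 (hM hm)
  refine hS.measure_forall_isStraightLocus (sceneryLocus n z) M (fun m hm => ?_) (fun m hm => ?_)
    (fun m hm => ?_) (fun m hm => ?_) (fun m hm => ?_)
    (fun m _ m' _ => sceneryLocus_avoidsAll n z z m m')
    fun m _ m' _ hne => sceneryLocus_separated n fun e => absurd e hne
  · exact Int.natAbs_pos.2 hz
  · have := hlt m hm
    simp only [sceneryLocus]
    omega
  · simp [sceneryLocus]
  · have := hlt m hm
    simp only [sceneryLocus, Set.mem_uIcc]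
    omega
  · have := hlt m hm
    simp only [sceneryLocus, Set.mem_uIcc]
    omega

theorem IsSimpleRandomWalk.measure_sceneryLocus_pair {S : ℕ → Ω → ℤ} (hS : IsSimpleRandomWalk P S)
    {n : ℕ} {z z' : ℤ} (hz : z ≠ 0) (hz' : z' ≠ 0) (hne : z.natAbs ≠ z'.natAbs) {M : Finset ℕ}
    (hM : M ⊆ Finset.range n) :
    P {ω | ∀ m ∈ M, IsStraightLocus (fun k => S k ω) (sceneryLocus n z m) ∧
      IsStraightLocus (fun k => S k ω) (sceneryLocus n z' m)} = (3 / 4) ^ (2 * M.card) := by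
  have hlt : ∀ m ∈ M, m < n := fun m hm => Finset.mem_range.1 (hM hm)
  let y : Bool → ℤ := fun b => if b then z else z'
  have hy : ∀ b, y b ≠ 0 := fun b => by cases b <;> simp [y, hz, hz']
  have h := hS.measure_forall_isStraightLocus (fun b : ℕ × Bool => sceneryLocus n (y b.2) b.1)
    (M ×ˢ Finset.univ) (fun b _ => Int.natAbs_pos.2 (hy b.2)) (fun b hb => ?_) (fun b hb => ?_)
    (fun b hb => ?_) (fun b hb => ?_) (fun b _ c _ => sceneryLocus_avoidsAll n _ _ _ _)
    (fun b _ c _ hbc => sceneryLocus_separated n fun e => ?_)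
  · rw [Finset.card_product, Finset.card_univ, Fintype.card_bool, mul_comm] at h
    rw [← h]
    congr 1
    ext ω
    simp only [Set.mem_ofPred_eq, Finset.mem_product, Finset.mem_univ, and_true, Prod.forall,
      Bool.forall_bool, y, if_true, if_false, Bool.false_eq_true]
    exact forall_congr' fun m => by tauto
  · have := hlt b.1 (Finset.mem_product.1 hb).1
    simp only [sceneryLocus]
    omega
  · simp [sceneryLocus]
  · have := hlt b.1 (Finset.mem_product.1 hb).1
    simp only [sceneryLocus, Set.mem_uIcc]
    omega
  · have := hlt b.1 (Finset.mem_product.1 hb).1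
    simp only [sceneryLocus, Set.mem_uIcc]
    omega
  · obtain ⟨m, b⟩ := b
    obtain ⟨m', c⟩ := c
    cases b <;> cases c <;> simp_all [y, Ne.symm]

/-- If `za = zb`, the two families of loci coincide. Otherwise they are either separated loci of the
same half of R, or loci of the two independent halves, with the same probability in both cases. -/
theorem IsFairScenery.measure_sceneryLocus {ξ : ℤ → Ω → Fin 2} (hξ : IsFairScenery P ξ) {n : ℕ}
    {za zb : ℤ} (hza : za ≠ 0) (hzb : zb ≠ 0) {M : Finset ℕ} (hM : M ⊆ Finset.range n) :
    P {ω | ∀ m ∈ M,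
      IsStraightLocus (halfPath (sceneryWalk fun k => ξ k ω) za.sign) (sceneryLocus n za m) ∧
      IsStraightLocus (halfPath (sceneryWalk fun k => ξ k ω) zb.sign) (sceneryLocus n zb m)} =
      if za = zb then (3 / 4) ^ M.card else (3 / 4) ^ (2 * M.card) := by
  have hW : ∀ {z : ℤ}, z ≠ 0 → IsSimpleRandomWalk P fun k ω =>
      halfPath (sceneryWalk fun k => ξ k ω) z.sign k :=
    fun hz => hξ.isSimpleRandomWalk (sign_eq_one_or hz)
  split_ifs with h
  · subst h
    simp only [and_self]
    exact (hW hza).measure_sceneryLocus hza hM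
  · by_cases hs : za.sign = zb.sign
    · rw [← hs]
      refine (hW hza).measure_sceneryLocus_pair hza hzb (fun e => h ?_) hM
      rw [← Int.sign_mul_natAbs za, ← Int.sign_mul_natAbs zb, hs, e]
    · have hind : IndepFun (fun ω => halfPath (sceneryWalk fun k => ξ k ω) za.sign)
          (fun ω => halfPath (sceneryWalk fun k => ξ k ω) zb.sign) P := by
        rcases sign_eq_one_or hza with ea | ea <;> rcases sign_eq_one_or hzb with eb | eb <;>
          rw [ea, eb] at hs ⊢
        · exact absurd rfl hs
        · exact hξ.indepFun_sceneryWalk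
        · exact hξ.indepFun_sceneryWalk.symm
        · exact absurd rfl hs
      have hm : ∀ z, MeasurableSet {T : ℕ → ℤ | ∀ m ∈ M, IsStraightLocus T (sceneryLocus n z m)} := by
        intro z
        have : {T : ℕ → ℤ | ∀ m ∈ M, IsStraightLocus T (sceneryLocus n z m)} =
            ⋂ m ∈ M, {T | IsStraightLocus T (sceneryLocus n z m)} := by ext; simp
        rw [this]
        exact Finset.measurableSet_biInter _ fun m _ => measurableSet_isStraightLocus _
      have h1 := hind.measure_inter_preimage_eq_mul _ _ (hm za) (hm zb)
      have ha : P ((fun ω => halfPath (sceneryWalk fun k => ξ k ω) za.sign) ⁻¹'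
          {T | ∀ m ∈ M, IsStraightLocus T (sceneryLocus n za m)}) = (3 / 4) ^ M.card :=
        (hW hza).measure_sceneryLocus hza hM
      have hb : P ((fun ω => halfPath (sceneryWalk fun k => ξ k ω) zb.sign) ⁻¹'
          {T | ∀ m ∈ M, IsStraightLocus T (sceneryLocus n zb m)}) = (3 / 4) ^ M.card :=
        (hW hzb).measure_sceneryLocus hzb hM
      rw [ha, hb, ← pow_add, ← two_mul] at h1
      rw [← h1]
      congr 1
      ext ω
      simp only [Set.mem_inter_iff, Set.mem_preimage, Set.mem_ofPred_eq]
      exact ⟨fun h => ⟨fun m hm => (h m hm).1, fun m hm => (h m hm).2⟩,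
        fun h m hm => ⟨h.1 m hm, h.2 m hm⟩⟩

end Loci

/-! ### The event that both bits are one -/

/-- The pairs of paths for which both bits at `m` are one. The bound on the walk makes the event
depend on finitely many values of the paths for given crossing times. -/
def bothStraight (n ia ib : ℕ) (za zb : ℤ) (m : ℕ) : Set ((ℤ → ℤ) × (ℕ → ℤ)) :=
  {x | (∀ u : ℕ, |x.2 u| ≤ u) ∧ ∃ ta tb : ℕ × ℕ, IsIndexedCrossing x.1 x.2 n ia za ta ∧
    IsIndexedCrossing x.1 x.2 n ib zb tb ∧ straightBit (fun u => x.1 (x.2 u)) ta m = 1 ∧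
    straightBit (fun u => x.1 (x.2 u)) tb m = 1}

theorem IsIndexedCrossing.congr {r r' : ℤ → ℤ} {σ σ' : ℕ → ℤ} {n i : ℕ} {z : ℤ} (hz : z ≠ 0)
    {t : ℕ × ℕ} {N : ℕ} (hN : max t.1 t.2 ≤ N) (hr : ∀ k : ℤ, |k| ≤ N → r k = r' k)
    (hσ : ∀ k ≤ N, σ k = σ' k) (hb : ∀ u ≤ N, |σ u| ≤ N) (h : IsIndexedCrossing r σ n i z t) :
    IsIndexedCrossing r' σ' n i z t := by
  obtain ⟨k, h1, h2⟩ := h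
  obtain ⟨s, rfl, h3⟩ := (isSignedCrossing_iff hz).1 h1
  refine ⟨_, (isSignedCrossing_iff hz).2 ⟨s, rfl, h3.congr fun u hu => hr _ ?_⟩,
    h2.congr fun u hu => hσ u (hu.trans hN)⟩
  -- The crossing times of `r` are the values of `σ` at the ends of `t`, so the bound on `σ` keeps
  -- them where `r` and `r'` agree.
  have b1 := hb t.1 (by omega)
  have b2 := hb t.2 (by omega)
  rw [h2.1.2.1] at b1
  rw [h2.1.2.2.1] at b2
  rcases sign_eq_one_or hz with e | e <;> simp only [signedTimes, e, abs_eq_max_neg] at b1 b2 ⊢ <;>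
    omega

theorem straightBit_congr {T T' : ℕ → ℤ} {t : ℕ × ℕ} (h : ∀ u ∈ Set.uIcc t.1 t.2, T u = T' u)
    (m : ℕ) : straightBit T t m = straightBit T' t m := by
  unfold straightBit
  congr 1
  refine propext (exists_congr fun s => and_congr_left fun _ => ?_)
  exact ⟨fun hs => hs.congr h, fun hs => hs.congr fun u hu => (h u hu).symm⟩

theorem measurableSet_bothStraight (n ia ib : ℕ) {za zb : ℤ} (hza : za ≠ 0) (hzb : zb ≠ 0)
    (m : ℕ) : MeasurableSet (bothStraight n ia ib za zb m) := by
  have h1 : MeasurableSet {x : (ℤ → ℤ) × (ℕ → ℤ) | ∀ u : ℕ, |x.2 u| ≤ u} := by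
    have : {x : (ℤ → ℤ) × (ℕ → ℤ) | ∀ u : ℕ, |x.2 u| ≤ u} =
        ⋂ u : ℕ, (fun x : (ℤ → ℤ) × (ℕ → ℤ) => x.2 u) ⁻¹' {y : ℤ | |y| ≤ u} := by ext; simp
    rw [this]
    exact MeasurableSet.iInter fun u =>
      ((measurable_pi_apply u).comp measurable_snd) MeasurableSet.of_discrete
  have h2 : bothStraight n ia ib za zb m = {x | ∀ u : ℕ, |x.2 u| ≤ (u : ℤ)} ∩
      ⋃ t : (ℕ × ℕ) × (ℕ × ℕ), {x | (∀ u ≤ max (max t.1.1 t.1.2) (max t.2.1 t.2.2),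
        |x.2 u| ≤ ((max (max t.1.1 t.1.2) (max t.2.1 t.2.2) : ℕ) : ℤ)) ∧
        IsIndexedCrossing x.1 x.2 n ia za t.1 ∧ IsIndexedCrossing x.1 x.2 n ib zb t.2 ∧
        straightBit (fun u => x.1 (x.2 u)) t.1 m = 1 ∧
        straightBit (fun u => x.1 (x.2 u)) t.2 m = 1} := by
    ext x
    simp only [bothStraight, Set.mem_ofPred_eq, Set.mem_inter_iff, Set.mem_iUnion]
    refine and_congr_right fun hb => ?_
    constructor
    · rintro ⟨ta, tb, h⟩
      exact ⟨(ta, tb), fun u hu => (hb u).trans (by exact_mod_cast hu), h⟩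
    · rintro ⟨t, -, h⟩
      exact ⟨t.1, t.2, h⟩
  rw [h2]
  refine h1.inter (MeasurableSet.iUnion fun t => ?_)
  refine measurableSet_of_forall_eq
    (Q := fun r σ => (∀ u ≤ max (max t.1.1 t.1.2) (max t.2.1 t.2.2),
        |σ u| ≤ ((max (max t.1.1 t.1.2) (max t.2.1 t.2.2) : ℕ) : ℤ)) ∧
        IsIndexedCrossing r σ n ia za t.1 ∧ IsIndexedCrossing r σ n ib zb t.2 ∧
        straightBit (fun u => r (σ u)) t.1 m = 1 ∧ straightBit (fun u => r (σ u)) t.2 m = 1)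
    (max (max t.1.1 t.1.2) (max t.2.1 t.2.2)) ?_
  intro r r' σ σ' hr hσ ⟨hb, h3, h4, h5, h6⟩
  have hcomp : ∀ u ≤ max (max t.1.1 t.1.2) (max t.2.1 t.2.2), r (σ u) = r' (σ' u) := fun u hu => by
    rw [← hσ u hu]
    exact hr _ (hb u hu)
  refine ⟨fun u hu => by rw [← hσ u hu]; exact hb u hu,
    h3.congr hza (le_max_left _ _) hr hσ hb, h4.congr hzb (le_max_right _ _) hr hσ hb, ?_, ?_⟩
  · rw [← h5]
    exact straightBit_congr (fun u hu => (hcomp u (hu.2.trans (le_max_left _ _))).symm) m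
  · rw [← h6]
    exact straightBit_congr (fun u hu => (hcomp u (hu.2.trans (le_max_right _ _))).symm) m

theorem mem_bothStraight_iff {r : ℤ → ℤ} {σ : ℕ → ℤ} {n ia ib : ℕ} {za zb : ℤ} {ka kb : ℕ × ℕ}
    {ja jb : ℕ → ℕ × ℕ} (ha : IsCrossingData r n za ka ja) (hb : IsCrossingData r n zb kb jb)
    (hra : IsNearestNeighbor (halfPath r za.sign)) (hrb : IsNearestNeighbor (halfPath r zb.sign))
    (hσ : IsNearestNeighbor σ) (hσ0 : σ 0 = 0) (hσr : IsRecurrent σ) (hia : 0 < ia) (hib : 0 < ib)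
    {m : ℕ} (hm : m < n) :
    (r, σ) ∈ bothStraight n ia ib za zb m ↔
      (IsStraightLocus (halfPath r za.sign) (sceneryLocus n za m) ∧
        IsStraightLocus (halfPath r zb.sign) (sceneryLocus n zb m)) ∧
      IsStraightLocus σ (walkLocus za.sign ia ka (ja m)) ∧
        IsStraightLocus σ (walkLocus zb.sign ib kb (jb m)) := by
  constructor
  · rintro ⟨-, ta, tb, h1, h2, h3, h4⟩
    rw [ha.straightBit_eq_one_iff hra hσ h1 hm] at h3
    rw [hb.straightBit_eq_one_iff hrb hσ h2 hm] at h4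
    exact ⟨⟨h3.1, h4.1⟩, h3.2, h4.2⟩
  · rintro ⟨⟨h1, h2⟩, h3, h4⟩
    refine ⟨fun u => ?_, ?_⟩
    · have := hσ.abs_sub_le u 0
      rw [hσ0] at this
      simpa using this
    · obtain ⟨ta, hta⟩ := hσ.exists_isNthCrossing hσr ha.signed_ne (ia - 1)
      obtain ⟨tb, htb⟩ := hσ.exists_isNthCrossing hσr hb.signed_ne (ib - 1)
      rw [Nat.sub_add_cancel hia, ← ha.isIndexedCrossing_iff] at hta
      rw [Nat.sub_add_cancel hib, ← hb.isIndexedCrossing_iff] at htb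
      exact ⟨ta, tb, hta, htb, (ha.straightBit_eq_one_iff hra hσ hta hm).2 ⟨h1, h3⟩,
        (hb.straightBit_eq_one_iff hrb hσ htb hm).2 ⟨h2, h4⟩⟩

/-- R and S are independent, so R can be fixed first. If its loci are straight (the event `C`), they
give intervals of length three and `2 * M.card` separated loci of S; off `C` the conditional
probability is zero. Thus the factor of S is constant on `C` and the integral is a product. -/
theorem measure_forall_mem_bothStraight {Ω : Type*} [MeasurableSpace Ω] {P : Measure Ω}
    [IsProbabilityMeasure P] {ξ : ℤ → Ω → Fin 2} {S : ℕ → Ω → ℤ} (hξ : IsFairScenery P ξ)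
    (hS : IsSimpleRandomWalk P S) (hindep : IndepFun (fun ω k => ξ k ω) (fun ω k => S k ω) P)
    {n : ℕ} (hn : 0 < n) {za zb : ℤ} (hza : za ≠ 0) (hzb : zb ≠ 0) {ia ib : ℕ} (hia : 0 < ia)
    (hib : 0 < ib) (hab : (ia, za) ≠ (ib, zb)) {M : Finset ℕ} (hM : M ⊆ Finset.range n) :
    P {ω | ∀ m ∈ M, (sceneryWalk fun k => ξ k ω, fun k => S k ω) ∈
      bothStraight n ia ib za zb m} =
      (3 / 4) ^ (2 * M.card) * if za = zb then (3 / 4) ^ M.card else (3 / 4) ^ (2 * M.card) := by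
  have hlt : ∀ m ∈ M, m < n := fun m hm => Finset.mem_range.1 (hM hm)
  have hRm := hξ.measurable_sceneryWalk
  have hind : IndepFun (fun ω => sceneryWalk fun k => ξ k ω) (fun ω k => S k ω) P :=
    hindep.comp measurable_sceneryWalk measurable_id
  let A : Set ((ℤ → ℤ) × (ℕ → ℤ)) := ⋂ m ∈ M, bothStraight n ia ib za zb m
  have hA : MeasurableSet A :=
    Finset.measurableSet_biInter _ fun m _ => measurableSet_bothStraight n ia ib hza hzb m
  let C : Set Ω := {ω | ∀ m ∈ M,
      IsStraightLocus (halfPath (sceneryWalk fun k => ξ k ω) za.sign) (sceneryLocus n za m) ∧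
      IsStraightLocus (halfPath (sceneryWalk fun k => ξ k ω) zb.sign) (sceneryLocus n zb m)}
  have hWa : IsSimpleRandomWalk P fun k ω => halfPath (sceneryWalk fun k => ξ k ω) za.sign k :=
    hξ.isSimpleRandomWalk (sign_eq_one_or hza)
  have hWb : IsSimpleRandomWalk P fun k ω => halfPath (sceneryWalk fun k => ξ k ω) zb.sign k :=
    hξ.isSimpleRandomWalk (sign_eq_one_or hzb)
  have hC : MeasurableSet C := by
    have : C = ⋂ m ∈ M, ((fun ω => halfPath (sceneryWalk fun k => ξ k ω) za.sign) ⁻¹'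
        {T | IsStraightLocus T (sceneryLocus n za m)} ∩
        (fun ω => halfPath (sceneryWalk fun k => ξ k ω) zb.sign) ⁻¹'
        {T | IsStraightLocus T (sceneryLocus n zb m)}) := by
      ext ω
      simp [C]
    rw [this]
    exact Finset.measurableSet_biInter _ fun m _ =>
      (hWa.measurable_path (measurableSet_isStraightLocus _)).inter
        (hWb.measurable_path (measurableSet_isStraightLocus _))
  have hlaw := (indepFun_iff_map_prod_eq_prod_map_map hRm.aemeasurable
    hS.measurable_path.aemeasurable).1 hind
  have h1 : P {ω | ∀ m ∈ M, (sceneryWalk fun k => ξ k ω, fun k => S k ω) ∈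
      bothStraight n ia ib za zb m} =
      P.map (fun ω => (sceneryWalk fun k => ξ k ω, fun k => S k ω)) A := by
    rw [Measure.map_apply (hRm.prodMk hS.measurable_path) hA]
    congr 1
    ext ω
    simp [A]
  have : IsProbabilityMeasure (P.map fun ω k => S k ω) :=
    Measure.isProbabilityMeasure_map hS.measurable_path.aemeasurable
  have : IsProbabilityMeasure (P.map fun ω => sceneryWalk fun k => ξ k ω) :=
    Measure.isProbabilityMeasure_map hRm.aemeasurable
  rw [h1, hlaw, Measure.prod_apply hA, lintegral_map (measurable_measure_prodMk_left hA) hRm,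
    ← hξ.measure_sceneryLocus hza hzb hM]
  change _ = _ * P C
  rw [← lintegral_indicator_const hC]
  refine lintegral_congr_ae ?_
  filter_upwards [hWa.ae_step, hWa.ae_isRecurrent, hWb.ae_step, hWb.ae_isRecurrent]
    with ω ha1 ha2 hb1 hb2
  obtain ⟨ka, ja, ha⟩ := exists_isCrossingData hn hza ha1 ha2
  obtain ⟨kb, jb, hb⟩ := exists_isCrossingData hn hzb hb1 hb2
  rw [Measure.map_apply hS.measurable_path (measurable_prodMk_left hA)]
  have hae : P ((fun ω k => S k ω) ⁻¹' (Prod.mk (sceneryWalk fun k => ξ k ω) ⁻¹' A)) =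
      P {ω' | ω ∈ C ∧ ∀ m ∈ M,
        IsStraightLocus (fun k => S k ω') (walkLocus za.sign ia ka (ja m)) ∧
        IsStraightLocus (fun k => S k ω') (walkLocus zb.sign ib kb (jb m))} := by
    refine measure_congr ?_
    filter_upwards [hS.ae_step, hS.start, hS.ae_isRecurrent] with ω' s1 s2 s3
    refine propext ?_
    have key : ∀ m ∈ M, _ := fun m hm =>
      mem_bothStraight_iff ha hb ha1 hb1 s1 s2 s3 hia hib (hlt m hm)
    constructor
    · intro h
      have h' : ∀ m ∈ M, _ := fun m hm => (key m hm).1 (Set.mem_iInter₂.1 h m hm)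
      exact ⟨fun m hm => (h' m hm).1, fun m hm => (h' m hm).2⟩
    · rintro ⟨h2, h3⟩
      exact Set.mem_iInter₂.2 fun m hm => (key m hm).2 ⟨h2 m hm, h3 m hm⟩
  rw [hae]
  by_cases hω : ω ∈ C
  · rw [Set.indicator_of_mem hω]
    simp only [hω, true_and]
    exact hS.measure_walkLocus ha hb hia hib hab hM
      (fun m hm => (ha.isStraightLocus_iff (hlt m hm)).1 (hω m hm).1)
      (fun m hm => (hb.isStraightLocus_iff (hlt m hm)).1 (hω m hm).2)
  · rw [Set.indicator_of_notMem hω]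
    simp [hω]

theorem straightBit_eq_zero_or_one (T : ℕ → ℤ) (t : ℕ × ℕ) (m : ℕ) :
    straightBit T t m = 0 ∨ straightBit T t m = 1 := by
  unfold straightBit
  split_ifs <;> simp

open Classical in
theorem commonStraight_eq_card {r : ℤ → ℤ} {σ : ℕ → ℤ} (hσ : ∀ u : ℕ, |σ u| ≤ u) {n ia ib : ℕ}
    {za zb : ℤ} (hza : za ≠ 0) (hzb : zb ≠ 0) {ta tb : ℕ × ℕ}
    (ha : IsIndexedCrossing r σ n ia za ta) (hb : IsIndexedCrossing r σ n ib zb tb) :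
    commonStraight (fun u => r (σ u)) n ta tb =
      ((Finset.range n).filter fun m => (r, σ) ∈ bothStraight n ia ib za zb m).card := by
  rw [commonStraight, Finset.card_filter]
  refine Finset.sum_congr rfl fun m _ => ?_
  have hiff : (r, σ) ∈ bothStraight n ia ib za zb m ↔
      straightBit (fun u => r (σ u)) ta m = 1 ∧ straightBit (fun u => r (σ u)) tb m = 1 := by
    constructor
    · rintro ⟨-, ta', tb', h1, h2, h3, h4⟩
      rw [h1.unique hza ha] at h3
      rw [h2.unique hzb hb] at h4
      exact ⟨h3, h4⟩
    · exact fun h => ⟨hσ, ta, tb, ha, hb, h.1, h.2⟩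
  rw [hiff]
  rcases straightBit_eq_zero_or_one (fun u => r (σ u)) ta m with e | e <;>
    rcases straightBit_eq_zero_or_one (fun u => r (σ u)) tb m with e' | e' <;> simp [e, e']


/-! ### The distribution of the test statistic under both hypotheses. -/

theorem lemma8 {Ω : Type*} [MeasurableSpace Ω] (P : Measure Ω) [IsProbabilityMeasure P]
    (ξ : ℤ → Ω → Fin 2) (S : ℕ → Ω → ℤ)
    (hξ : IsFairScenery P ξ) (hS : IsSimpleRandomWalk P S)
    (hindep : IndepFun (fun ω k => ξ k ω) (fun ω k => S k ω) P)
    (R : Ω → ℤ → ℤ) (hR : R = fun ω => sceneryWalk (fun k => ξ k ω))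
    (T : Ω → ℕ → ℤ) (hT : T = fun ω k => R ω (S k ω))
    (n : ℕ) (hn : 0 < n) (za zb : ℤ) (hza : za ≠ 0) (hzb : zb ≠ 0)
    (ia ib : ℕ) (hia : 0 < ia) (hib : 0 < ib) (hab : (ia, za) ≠ (ib, zb))
    (ta tb : Ω → ℕ × ℕ)
    (hta : ta = fun ω => indexedCrossing (R ω) (fun k => S k ω) n ia za)
    (htb : tb = fun ω => indexedCrossing (R ω) (fun k => S k ω) n ib zb) :
    (∀ᵐ ω ∂P,
      IsIndexedCrossing (R ω) (fun k => S k ω) n ia za (ta ω) ∧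
      IsIndexedCrossing (R ω) (fun k => S k ω) n ib zb (tb ω) ∧
      IsCrossing (T ω) 0 (3 * n) (ta ω) ∧ IsCrossing (T ω) 0 (3 * n) (tb ω)) ∧
    (za = zb →
      (∀ᵐ ω ∂P, (S (ta ω).1 ω, S (ta ω).2 ω) = (S (tb ω).1 ω, S (tb ω).2 ω)) ∧
      HasLaw (fun ω => commonStraight (T ω) n (ta ω) (tb ω)) (binomial n (threeQuarters ^ 3)) P) ∧
    (za ≠ zb →
      (∀ᵐ ω ∂P, (S (ta ω).1 ω, S (ta ω).2 ω) ≠ (S (tb ω).1 ω, S (tb ω).2 ω)) ∧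
      HasLaw (fun ω => commonStraight (T ω) n (ta ω) (tb ω)) (binomial n (threeQuarters ^ 4)) P) := by
  have hindexed : ∀ {z : ℤ} {i : ℕ}, z ≠ 0 → 0 < i → ∀ᵐ ω ∂P, IsIndexedCrossing (R ω)
      (fun k => S k ω) n i z (indexedCrossing (R ω) (fun k => S k ω) n i z) := by
    intro z i hz hi
    have hW : IsSimpleRandomWalk P fun k ω => halfPath (sceneryWalk fun k => ξ k ω) z.sign k :=
      hξ.isSimpleRandomWalk (sign_eq_one_or hz)
    subst hR
    filter_upwards [hW.ae_step, hW.ae_isRecurrent, hS.ae_step, hS.ae_isRecurrent]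
      with ω h1 h2 h3 h4
    obtain ⟨k, j, h⟩ := exists_isCrossingData hn hz h1 h2
    obtain ⟨t, ht⟩ := h3.exists_isNthCrossing h4 h.signed_ne (i - 1)
    rw [Nat.sub_add_cancel hi, ← h.isIndexedCrossing_iff] at ht
    exact Classical.epsilon_spec ⟨t, ht⟩
  have ha : ∀ᵐ ω ∂P, IsIndexedCrossing (R ω) (fun k => S k ω) n ia za (ta ω) := by
    rw [hta]
    exact hindexed hza hia
  have hb : ∀ᵐ ω ∂P, IsIndexedCrossing (R ω) (fun k => S k ω) n ib zb (tb ω) := by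
    rw [htb]
    exact hindexed hzb hib
  -- Both hypotheses share this argument; the parameter `p` only has to match the probability that
  -- both bits are 1 at all of `c` given indices.
  have hlaw : ∀ p : unitInterval,
      (∀ c : ℕ, (3 / 4 : ENNReal) ^ (2 * c) *
        (if za = zb then (3 / 4) ^ c else (3 / 4) ^ (2 * c)) = ENNReal.ofReal ((p : ℝ) ^ c)) →
      HasLaw (fun ω => commonStraight (T ω) n (ta ω) (tb ω)) (binomial n p) P := by
    intro p hp
    subst hR
    have hE : ∀ m, MeasurableSet {ω | (sceneryWalk fun k => ξ k ω, fun k => S k ω) ∈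
        bothStraight n ia ib za zb m} := fun m =>
      (hξ.measurable_sceneryWalk.prodMk hS.measurable_path)
        (measurableSet_bothStraight n ia ib hza hzb m)
    refine (hasLaw_binomial_of_measure_inter hE (p := p) fun M hM => ?_).congr ?_
    · have h := measure_forall_mem_bothStraight hξ hS hindep hn hza hzb hia hib hab hM
      rw [hp] at h
      rw [measureReal_def]
      change (P {ω | ∀ m ∈ M, (sceneryWalk fun k => ξ k ω, fun k => S k ω) ∈
        bothStraight n ia ib za zb m}).toReal = _
      rw [h, ENNReal.toReal_ofReal (pow_nonneg p.2.1 _)]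
    · filter_upwards [ha, hb, hS.ae_step, hS.start] with ω h1 h2 h3 h4
      rw [hT]
      refine commonStraight_eq_card (fun u => ?_) hza hzb h1 h2
      have := h3.abs_sub_le u 0
      beta_reduce at this
      rw [h4] at this
      simpa using this
  refine ⟨?_, fun hz => ⟨?_, hlaw _ fun c => ?_⟩, fun hz => ⟨?_, hlaw _ fun c => ?_⟩⟩
  · filter_upwards [ha, hb] with ω h1 h2
    refine ⟨h1, h2, ?_, ?_⟩
    · obtain ⟨k, hk, ht⟩ := h1
      rw [hT]
      exact hk.1.comp ht.1
    · obtain ⟨k, hk, ht⟩ := h2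
      rw [hT]
      exact hk.1.comp ht.1
  · filter_upwards [ha, hb] with ω ⟨k, h1, h2⟩ ⟨k', h1', h2'⟩
    subst hz
    obtain rfl := h1.unique hza h1'
    exact Prod.ext (h2.1.2.1.trans h2'.1.2.1.symm) (h2.1.2.2.1.trans h2'.1.2.2.1.symm)
  · rw [if_pos hz, ← pow_add, ← ENNReal.ofReal_ofNat 3, ← ENNReal.ofReal_ofNat 4,
      ← ENNReal.ofReal_div_of_pos (by norm_num), ← ENNReal.ofReal_pow (by norm_num)]
    congr 1
    simp only [threeQuarters, Set.Icc.coe_pow, ← pow_mul]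
    ring
  · filter_upwards [ha, hb] with ω ⟨k, h1, h2⟩ ⟨k', h1', h2'⟩ heq
    -- The values of S at the ends of its crossing are the two times of the crossing by R, and these
    -- determine the number `z`.
    refine hz (h1.index_unique (k := k) ?_)
    have : k = k' := by
      rw [Prod.mk.injEq] at heq
      exact Prod.ext (h2.1.2.1.symm.trans (heq.1.trans h2'.1.2.1))
        (h2.1.2.2.1.symm.trans (heq.2.trans h2'.1.2.2.1))
    rwa [this]
  · rw [if_neg hz, ← pow_add, ← ENNReal.ofReal_ofNat 3, ← ENNReal.ofReal_ofNat 4,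
      ← ENNReal.ofReal_div_of_pos (by norm_num), ← ENNReal.ofReal_pow (by norm_num)]
    congr 1
    simp only [threeQuarters, Set.Icc.coe_pow, ← pow_mul]
    ring
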